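/- Let $0<p<1$ and $\lambda\ge 2$. There is a constant $c_{p,\lambda}<\infty$, depending only on $p$ and $\lambda$, such that the following holds for every sequence $m=(m_0,m_1,\dots)$ of integers with $2\le m_k\le\lambda$ for all $k$. Let $G_m=\prod_{k\ge0}\mathbb Z/m_k\mathbb Z$ be the (bounded) Vilenkin group with its normalized Haar measure $\mu$ (the product of the uniform measures on the factors), and let $M_0=1$, $M_{k+1}=m_kM_k$. For $n=\sum_k n_kM_k$ with $0\le n_k<m_k$, let $\psi_n(x)=\prod_k r_k(x)^{n_k}$, where $r_k(x)=\exp(2\pi i x_k/m_k)$. Let $F_n$ be the $\sigma$-algebra generated by the sets $I_n(x)=\{y\in G_m: y_j=x_j \text{ for } j<n\}$, $x\in G_m$. Let $f=(f_n)_{n\in\mathbb N}$ be a complex-valued martingale with respect to $(F_n)_{n\in\mathbb N}$ in the Hardy space $H_p(G_m)$, that is, with $\|f\|_{H_p}:=\|\sup_n|f_n|\|_p<\infty$, where $\|g\|_p=\left(\int_{G_m}|g|^p\,d\mu\right)^{1/p}$. Put $\widehat f(i)=\lim_{k\to\infty}\int_{G_m}f_k\overline{\psi_i}\,d\mu$ and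 $S_kf=\sum_{i=0}^{k-1}\widehat f(i)\psi_i$. Then $$\sum_{k=1}^{\infty}\frac{\|S_kf\|_p^p}{k^{2-p}}\le c_{p,\lambda}\,\|f\|_{H_p}^p .$$ -/

import Mathlib

open MeasureTheory Filter Topology
open scoped ENNReal NNReal

namespace Vilenkin

/-- The Vilenkin group `G_m`: the complete direct product of the groups `Z_{m_k}` of integers
modulo `m_k`, for a sequence `m` of integers (all at least 2 in the theorem).  It carries the
product group structure, topology and `σ`-algebra. -/
abbrev G (m : ℕ → ℕ) : Type := ∀ k, ZMod (m k)

/-- The measure on `Z_{m_k}` giving each point the mass `1 / m_k`. -/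
noncomputable def coordMeasure (m : ℕ → ℕ) (k : ℕ) : Measure (ZMod (m k)) :=
  (m k : ℝ≥0∞)⁻¹ • Measure.count

/-- The normalized Haar measure of `G_m`: the direct product of the measures on the factors. -/
noncomputable def haar (m : ℕ → ℕ) : Measure (G m) :=
  Measure.infinitePi (coordMeasure m)

/-- The interval `I_n(x)`: the points that agree with `x` in the coordinates `0, …, n - 1`. -/
def interval (m : ℕ → ℕ) (n : ℕ) (x : G m) : Set (G m) :=
  {y | ∀ j < n, y j = x j}

/-- The generalized powers `M_0 = 1`, `M_{k+1} = m_k M_k`. -/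
def M (m : ℕ → ℕ) : ℕ → ℕ
  | 0 => 1
  | k + 1 => m k * M m k

/-- The digit `n_k` in the expansion `n = ∑ n_j M_j` with `0 ≤ n_j < m_j`. -/
def digit (m : ℕ → ℕ) (n k : ℕ) : ℕ := n / M m k % m k

theorem two_pow_le_M {m : ℕ → ℕ} (hm : ∀ k, 2 ≤ m k) (k : ℕ) : 2 ^ k ≤ M m k := by
  induction k with
  | zero => simp [M]
  | succ k ih =>
    rw [pow_succ, mul_comm]
    exact Nat.mul_le_mul (hm k) ih

/-- All digits of `n` at positions `k ≥ n` vanish. -/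
theorem digit_eq_zero {m : ℕ → ℕ} (hm : ∀ k, 2 ≤ m k) {n k : ℕ} (h : n ≤ k) :
    digit m n k = 0 := by
  have h1 : n < M m k := lt_of_le_of_lt h (lt_of_lt_of_le Nat.lt_two_pow_self (two_pow_le_M hm k))
  simp [digit, Nat.div_eq_of_lt h1]

/-- The generalized Rademacher function `r_k(x) = exp(2πi x_k / m_k)`. -/
noncomputable def rademacher (m : ℕ → ℕ) (k : ℕ) (x : G m) : ℂ :=
  Complex.exp (2 * Real.pi * Complex.I * ((x k).val : ℂ) / (m k : ℂ))

/-- The Vilenkin function `ψ_n = ∏_k r_k ^ {n_k}`.  By `digit_eq_zero`, the factors with `k ≥ n`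
are equal to 1, so that the product over `k < n` is the full product. -/
noncomputable def psi (m : ℕ → ℕ) (n : ℕ) (x : G m) : ℂ :=
  ∏ k ∈ Finset.range n, rademacher m k x ^ digit m n k

/-- The `σ`-algebra `F_n` generated by the intervals `I_n(x)`, `x ∈ G_m`. -/
@[reducible] def sigmaAlg (m : ℕ → ℕ) (n : ℕ) : MeasurableSpace (G m) :=
  MeasurableSpace.generateFrom (Set.range (interval m n))

theorem measurableSet_interval (m : ℕ → ℕ) (n : ℕ) (x : G m) :
    MeasurableSet (interval m n x) := by
  have h : interval m n x = ⋂ j, ⋂ (_ : j < n), (fun y : G m => y j) ⁻¹' {x j} := by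
    ext y
    simp [interval]
  rw [h]
  exact MeasurableSet.iInter fun j => MeasurableSet.iInter fun _ =>
    measurable_pi_apply j (measurableSet_singleton _)

theorem countable_zmod (n : ℕ) : Countable (ZMod n) := by
  cases n with
  | zero => exact inferInstanceAs (Countable ℤ)
  | succ n => exact inferInstanceAs (Countable (Fin (n + 1)))

theorem sigmaAlg_le_succ (m : ℕ → ℕ) (n : ℕ) : sigmaAlg m n ≤ sigmaAlg m (n + 1) := by
  refine MeasurableSpace.generateFrom_le ?_
  rintro _ ⟨x, rfl⟩
  have h : interval m n x = ⋃ a : ZMod (m n), interval m (n + 1) (Function.update x n a) := by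
    ext y
    simp only [interval, Set.mem_ofPred_eq, Set.mem_iUnion]
    constructor
    · intro hy
      refine ⟨y n, fun j hj => ?_⟩
      rcases Nat.lt_succ_iff_lt_or_eq.mp hj with h1 | rfl
      · rw [Function.update_of_ne h1.ne, hy j h1]
      · simp
    · rintro ⟨a, ha⟩ j hj
      rw [ha j (by omega), Function.update_of_ne hj.ne]
  rw [h]
  have := countable_zmod (m n)
  exact MeasurableSet.iUnion fun a => MeasurableSpace.measurableSet_generateFrom ⟨_, rfl⟩

/-- The filtration `(F_n)` of `G_m`. -/
def filtration (m : ℕ → ℕ) : Filtration ℕ (MeasurableSpace.pi : MeasurableSpace (G m)) where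
  seq := sigmaAlg m
  mono' := monotone_nat_of_le_succ (sigmaAlg_le_succ m)
  le' n := by
    refine MeasurableSpace.generateFrom_le ?_
    rintro _ ⟨x, rfl⟩
    exact measurableSet_interval m n x

/-- The maximal function `f^* = sup_n |f_n|` (possibly infinite). -/
noncomputable def maximalFunction {m : ℕ → ℕ} (f : ℕ → G m → ℂ) (x : G m) : ℝ≥0∞ :=
  ⨆ n, ‖f n x‖ₑ

/-- `‖f‖_{H_p} = ‖f^*‖_p`, as an extended nonnegative number. -/
noncomputable def hardyNorm {m : ℕ → ℕ} (p : ℝ) (f : ℕ → G m → ℂ) : ℝ≥0∞ :=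
  eLpNorm (maximalFunction f) (ENNReal.ofReal p) (haar m)

/-- Membership in the martingale Hardy space `H_p(G_m)`. -/
def MemHardy {m : ℕ → ℕ} (p : ℝ) (f : ℕ → G m → ℂ) : Prop :=
  Martingale f (filtration m) (haar m) ∧ hardyNorm p f < ∞

/-- The Vilenkin-Fourier coefficient `lim_k ∫ f_k conj(ψ_i) dμ` of a martingale `f`.  The sequence
is constant from the index `k` on as soon as `i < M_k`, so that the limit exists. -/
noncomputable def fourierCoeff {m : ℕ → ℕ} (f : ℕ → G m → ℂ) (i : ℕ) : ℂ :=
  limUnder atTop fun k : ℕ => ∫ x, f k x * starRingEnd ℂ (psi m i x) ∂(haar m)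

/-- The partial sum `S_n f = ∑_{k < n} f^(k) ψ_k` of the Vilenkin-Fourier series. -/
noncomputable def partialSum {m : ℕ → ℕ} (f : ℕ → G m → ℂ) (n : ℕ) (x : G m) : ℂ :=
  ∑ k ∈ Finset.range n, fourierCoeff f k * psi m k x

end Vilenkin

/-! The proof is an atomic decomposition at the levels of the maximal function, with one estimate
for each atom. Atoms (`weightedSum_atom_le`): let `g` be bounded by `A`, live on an interval of
measure `1 / M_N`, and have no coefficients below `M_N`. Then `S_k g = 0` for `k ≤ M_N`. For larger
`k`, the bound of the Dirichlet kernel by a sum of normalized indicators (`norm_dirichlet_sub_le`)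
controls `S_k g` both on and off the interval. The tails off the interval cost `∑ M_s ^ (p - 1)`,
finite because `p < 1`, and the weight `k ^ (p - 2)` makes the blocks `M_n ≤ k < M_{n+1}` decay
geometrically. The total is at most a constant times `A ^ p / M_N`. Decomposition
(`weightedSum_layer_le`): `f` is stopped predictably, just before its modulus can exceed `2 ^ j *
t`. The difference of two consecutive stopped martingales splits into atoms of height about `2 ^ j *
t`, one on each interval where the lower level is exited. Such an interval has a child on which `f^*
> 2 ^ j * t`; since `m_n ≤ L`, all of them together have measure at most `L * μ(f^* > 2 ^ j * t)`.
As `‖·‖_p ^ p` is subadditive, the atoms add up to `∑ (2 ^ j * t) ^ p * μ(f^* > 2 ^ j * t)`, which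
is comparable to `∫ (f^*) ^ p`. What remains below level `t` is a bounded function, treated as an
atom on all of `G_m`; `t` then decreases to `‖f‖_{H_p}`. -/

namespace Vilenkin

/-! ### Intervals, functions of finitely many coordinates, and their measure. -/

section Cubes

variable {m : ℕ → ℕ}

theorem mem_interval_self (n : ℕ) (x : G m) : x ∈ interval m n x := fun _ _ => rfl

theorem mem_interval_comm {n : ℕ} {x y : G m} : y ∈ interval m n x ↔ x ∈ interval m n y :=
  ⟨fun h j hj => (h j hj).symm, fun h j hj => (h j hj).symm⟩

theorem mem_interval_trans {n : ℕ} {x y z : G m} (hxy : y ∈ interval m n x)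
    (hyz : z ∈ interval m n y) : z ∈ interval m n x :=
  fun j hj => (hyz j hj).trans (hxy j hj)

theorem interval_anti {i n : ℕ} (h : i ≤ n) (x : G m) : interval m n x ⊆ interval m i x :=
  fun _ hy j hj => hy j (hj.trans_le h)

theorem mem_interval_zero (x y : G m) : y ∈ interval m 0 x := fun _ hj => absurd hj (by omega)

/-- The function `h` depends on the first `n` coordinates only. -/
def DependsOnFirst {β : Type*} (n : ℕ) (h : G m → β) : Prop :=
  ∀ ⦃x y⦄, y ∈ interval m n x → h y = h x

theorem DependsOnFirst.mono {β : Type*} {i n : ℕ} {h : G m → β} (hh : DependsOnFirst i h)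
    (hin : i ≤ n) : DependsOnFirst n h :=
  fun x _ hy => hh (interval_anti hin x hy)

theorem DependsOnFirst.comp {β γ : Type*} {n : ℕ} {h : G m → β} (hh : DependsOnFirst n h)
    (g : β → γ) : DependsOnFirst n (fun x => g (h x)) :=
  fun _ _ hy => congrArg g (hh hy)

theorem dependsOnFirst_mem_interval (n : ℕ) (c : G m) :
    DependsOnFirst n (fun x => x ∈ interval m n c) := fun _ _ hy =>
  propext ⟨fun h => mem_interval_trans h (mem_interval_comm.1 hy),
    fun h => mem_interval_trans h hy⟩

/-- The intervals of length `n`, encoded by their common first `n` coordinates. -/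
abbrev Cube (m : ℕ → ℕ) (n : ℕ) : Type := ∀ k : Fin n, ZMod (m k)

/-- The first `n` coordinates of a point. -/
def trunc (n : ℕ) (x : G m) : Cube m n := fun k => x k

/-- A point in a given interval. -/
def Cube.center {n : ℕ} (q : Cube m n) : G m := fun k => if h : k < n then q ⟨k, h⟩ else 0

theorem mem_interval_center {n : ℕ} {q : Cube m n} {x : G m} :
    x ∈ interval m n q.center ↔ trunc n x = q := by
  constructor
  · intro h
    funext k
    simpa [Cube.center, trunc] using h k k.2
  · rintro rfl j hj
    simp [Cube.center, hj, trunc]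

theorem DependsOnFirst.apply_center {β : Type*} {n : ℕ} {h : G m → β} (hh : DependsOnFirst n h)
    (x : G m) : h (trunc n x).center = h x :=
  (hh (mem_interval_center.2 (rfl : trunc n x = trunc n x))).symm

theorem measurable_trunc (n : ℕ) : Measurable (trunc n : G m → Cube m n) :=
  measurable_pi_lambda _ fun _ => measurable_pi_apply _

theorem DependsOnFirst.measurable {β : Type*} [MeasurableSpace β] {n : ℕ} {h : G m → β}
    (hh : DependsOnFirst n h) : Measurable h := by
  have h1 : h = (fun q : Cube m n => h q.center) ∘ trunc n :=
    funext fun x => (hh.apply_center x).symm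
  rw [h1]
  have : ∀ k, Countable (ZMod (m k)) := fun k => countable_zmod _
  exact (measurable_of_countable _).comp (measurable_trunc n)

theorem M_eq_prod (n : ℕ) : M m n = ∏ k ∈ Finset.range n, m k := by
  induction n with
  | zero => rfl
  | succ n ih => rw [Finset.prod_range_succ, ← ih, M, mul_comm]

variable [∀ k, NeZero (m k)]

theorem DependsOnFirst.exists_norm_le {n : ℕ} {h : G m → ℂ} (hh : DependsOnFirst n h) :
    ∃ B : ℝ, 0 ≤ B ∧ ∀ x, ‖h x‖ ≤ B := by
  refine ⟨∑ q : Cube m n, ‖h q.center‖, Finset.sum_nonneg fun _ _ => norm_nonneg _, fun x => ?_⟩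
  rw [← hh.apply_center x]
  exact Finset.single_le_sum (f := fun q : Cube m n => ‖h q.center‖)
    (fun _ _ => norm_nonneg _) (Finset.mem_univ _)

instance isProbabilityMeasure_coordMeasure (k : ℕ) : IsProbabilityMeasure (coordMeasure m k) := by
  constructor
  have h : (m k : ℝ≥0∞) ≠ 0 := by exact_mod_cast NeZero.ne (m k)
  simp [coordMeasure, ENat.card_eq_coe_fintype_card, ZMod.card,
    ENNReal.inv_mul_cancel h (ENNReal.natCast_ne_top _)]

instance isProbabilityMeasure_haar : IsProbabilityMeasure (haar m) := by
  unfold haar; infer_instance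

theorem haar_interval (n : ℕ) (x : G m) : haar m (interval m n x) = (M m n : ℝ≥0∞)⁻¹ := by
  have h1 : interval m n x = Set.pi (Finset.range n : Finset ℕ) (fun j => {x j}) := by
    ext y; simp [interval]
  rw [h1, haar, Measure.infinitePi_pi _ (fun i _ => measurableSet_singleton _), M_eq_prod]
  simp only [coordMeasure, Measure.smul_apply, Measure.count_singleton, smul_eq_mul, mul_one,
    Nat.cast_prod]
  induction n with
  | zero => simp
  | succ n ih =>
    rw [Finset.prod_range_succ, Finset.prod_range_succ, ih ?_, ENNReal.mul_inv]
    · right; exact ENNReal.natCast_ne_top _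
    · right; exact_mod_cast NeZero.ne (m n)
    · ext y; simp [interval]

theorem DependsOnFirst.integrable {n : ℕ} {h : G m → ℂ} (hh : DependsOnFirst n h) :
    Integrable h (haar m) := by
  obtain ⟨B, -, hB⟩ := hh.exists_norm_le
  exact Integrable.of_bound hh.measurable.aestronglyMeasurable B (.of_forall hB)

end Cubes

/-! ### Vilenkin functions and bounds for the Dirichlet kernel. -/

section Characters

variable {m : ℕ → ℕ}

theorem M_pos (hm : ∀ k, 2 ≤ m k) (n : ℕ) : 0 < M m n :=
  lt_of_lt_of_le (by positivity) (two_pow_le_M hm n)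

theorem M_dvd_M {k s : ℕ} (h : k ≤ s) : M m k ∣ M m s := by
  induction s, h using Nat.le_induction with
  | base => rfl
  | succ s _ ih => exact ih.trans (Dvd.intro_left _ rfl)

theorem M_mono (hm : ∀ k, 2 ≤ m k) : Monotone (M m) :=
  fun _ s h => Nat.le_of_dvd (M_pos hm s) (M_dvd_M h)

theorem digit_eq_zero_of_lt {n k : ℕ} (h : n < M m k) : digit m n k = 0 := by
  simp [digit, Nat.div_eq_of_lt h]

theorem digit_mul_add_of_lt (hm : ∀ k, 2 ≤ m k) {s k : ℕ} (hk : k < s) (j i : ℕ) :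
    digit m (j * M m s + i) k = digit m i k := by
  obtain ⟨c, hc⟩ := M_dvd_M (m := m) (Nat.succ_le_of_lt hk)
  have h1 : j * M m s + i = i + M m k * (m k * (j * c)) := by
    rw [hc, Nat.succ_eq_add_one, M]; ring
  rw [digit, h1, Nat.add_mul_div_left _ _ (M_pos hm k), Nat.add_mul_mod_self_left, digit]

theorem digit_mul_add_of_le (hm : ∀ k, 2 ≤ m k) {s k : ℕ} (hk : s ≤ k) (j : ℕ) {i : ℕ}
    (hi : i < M m s) : digit m (j * M m s + i) k = digit m (j * M m s) k := by
  obtain ⟨c, hc⟩ := M_dvd_M (m := m) hk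
  rw [digit, digit, hc, ← Nat.div_div_eq_div_mul, ← Nat.div_div_eq_div_mul, mul_comm j,
    Nat.mul_add_div (M_pos hm s), Nat.div_eq_of_lt hi, add_zero, Nat.mul_div_cancel_left _
    (M_pos hm s)]

theorem psi_eq_prod (hm : ∀ k, 2 ≤ m k) {n K : ℕ} (h : n < M m K) (x : G m) :
    psi m n x = ∏ k ∈ Finset.range K, rademacher m k x ^ digit m n k := by
  have h1 : psi m n x = ∏ k ∈ Finset.range (max n K), rademacher m k x ^ digit m n k := by
    refine Finset.prod_subset (Finset.range_mono (le_max_left _ _)) fun k _ hk => ?_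
    rw [digit_eq_zero hm (by simpa using hk), pow_zero]
  rw [h1]
  symm
  refine Finset.prod_subset (Finset.range_mono (le_max_right _ _)) fun k _ hk => ?_
  rw [digit_eq_zero_of_lt (h.trans_le (M_mono hm (by simpa using hk))), pow_zero]

theorem lt_M (hm : ∀ k, 2 ≤ m k) (n : ℕ) : n < M m n :=
  Nat.lt_two_pow_self.trans_le (two_pow_le_M hm n)

/-- There are no carries: `j * M_s` has digits only from position `s` on, and `i` only before it. -/
theorem psi_mul_add (hm : ∀ k, 2 ≤ m k) {s i : ℕ} (j : ℕ) (hi : i < M m s) (x : G m) :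
    psi m (j * M m s + i) x = psi m (j * M m s) x * psi m i x := by
  have hK := lt_M hm (j * M m s + i)
  rw [psi_eq_prod hm hK, psi_eq_prod hm (n := j * M m s) (K := j * M m s + i) (by omega),
    psi_eq_prod hm (n := i) (K := j * M m s + i) (by omega), ← Finset.prod_mul_distrib]
  refine Finset.prod_congr rfl fun k _ => ?_
  rw [← pow_add]
  congr 1
  rcases lt_or_ge k s with hk | hk
  · have h2 := digit_mul_add_of_lt hm hk j 0
    rw [add_zero] at h2
    rw [digit_mul_add_of_lt hm hk, h2]
    simp [digit]
  · rw [digit_mul_add_of_le hm hk j hi, digit_eq_zero_of_lt (hi.trans_le (M_mono hm hk)), add_zero]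

theorem psi_mul_M (hm : ∀ k, 2 ≤ m k) {s l : ℕ} (hl : l < m s) (x : G m) :
    psi m (l * M m s) x = rademacher m s x ^ l := by
  have h1 : l * M m s < M m (s + 1) := by
    rw [M]; exact Nat.mul_lt_mul_of_pos_right hl (M_pos hm s)
  have h2 : digit m (l * M m s) s = l := by
    rw [digit, Nat.mul_div_cancel _ (M_pos hm s), Nat.mod_eq_of_lt hl]
  rw [psi_eq_prod hm h1, Finset.prod_range_succ, Finset.prod_eq_one, one_mul, h2]
  intro k hk
  have h3 := digit_mul_add_of_lt hm (Finset.mem_range.1 hk) l 0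
  rw [add_zero] at h3
  rw [h3]
  simp [digit]

theorem rademacher_congr {k : ℕ} {x y : G m} (h : y k = x k) :
    rademacher m k y = rademacher m k x := by simp [rademacher, h]

theorem psi_congr (hm : ∀ k, 2 ≤ m k) {i n : ℕ} (hi : i < M m n) {x y : G m}
    (h : y ∈ interval m n x) : psi m i y = psi m i x := by
  rw [psi_eq_prod hm hi, psi_eq_prod hm hi]
  exact Finset.prod_congr rfl fun k hk => by
    rw [rademacher_congr (h k (Finset.mem_range.1 hk))]

theorem norm_rademacher (k : ℕ) (x : G m) : ‖rademacher m k x‖ = 1 := by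
  have h : 2 * Real.pi * Complex.I * ((x k).val : ℂ) / (m k : ℂ)
      = ((2 * Real.pi * (x k).val / m k : ℝ) : ℂ) * Complex.I := by push_cast; ring
  rw [rademacher, h, Complex.norm_exp_ofReal_mul_I]

theorem norm_psi (n : ℕ) (x : G m) : ‖psi m n x‖ = 1 := by
  simp [psi, norm_prod, norm_rademacher]

/-- The Dirichlet kernel `D_k = ∑_{i < k} ψ_i`. -/
noncomputable def dirichlet (m : ℕ → ℕ) (k : ℕ) (x : G m) : ℂ := ∑ i ∈ Finset.range k, psi m i x

theorem norm_dirichlet_le (k : ℕ) (x : G m) : ‖dirichlet m k x‖ ≤ k := by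
  refine (norm_sum_le _ _).trans ?_
  simp [norm_psi]

theorem dirichlet_mul_add (hm : ∀ k, 2 ≤ m k) {s i : ℕ} (j : ℕ) (hi : i ≤ M m s) (x : G m) :
    dirichlet m (j * M m s + i) x
      = dirichlet m (j * M m s) x + psi m (j * M m s) x * dirichlet m i x := by
  rw [dirichlet, Finset.sum_range_add, dirichlet, dirichlet, Finset.mul_sum]
  congr 1
  exact Finset.sum_congr rfl fun l hl =>
    psi_mul_add hm j ((Finset.mem_range.1 hl).trans_le hi) x

theorem dirichlet_mul (hm : ∀ k, 2 ≤ m k) (s j : ℕ) (x : G m) :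
    dirichlet m (j * M m s) x
      = (∑ l ∈ Finset.range j, psi m (l * M m s) x) * dirichlet m (M m s) x := by
  induction j with
  | zero => simp [dirichlet]
  | succ j ih =>
    rw [add_mul, one_mul, dirichlet_mul_add hm j le_rfl, ih, Finset.sum_range_succ, add_mul]

variable [∀ k, NeZero (m k)]

theorem rademacher_eq_stdAddChar (k : ℕ) (x : G m) :
    rademacher m k x = ZMod.stdAddChar (x k) := by
  rw [ZMod.stdAddChar_apply, ZMod.toCircle_apply, rademacher]

theorem rademacher_sub (k : ℕ) (x t : G m) :
    rademacher m k (x - t) = rademacher m k x * starRingEnd ℂ (rademacher m k t) := by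
  have h : starRingEnd ℂ (rademacher m k t) = (rademacher m k t)⁻¹ := by
    rw [Complex.inv_def, Complex.normSq_eq_norm_sq, norm_rademacher]; simp
  rw [h]
  simp only [rademacher_eq_stdAddChar, Pi.sub_apply, AddChar.map_sub_eq_div, div_eq_mul_inv]

theorem psi_sub (n : ℕ) (x t : G m) :
    psi m n (x - t) = psi m n x * starRingEnd ℂ (psi m n t) := by
  simp only [psi, map_prod, ← Finset.prod_mul_distrib, map_pow, ← mul_pow, rademacher_sub]

theorem dirichlet_M_succ_eq_zero (hm : ∀ k, 2 ≤ m k) {s : ℕ} {x : G m} (hx : x s ≠ 0) :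
    dirichlet m (M m (s + 1)) x = 0 := by
  rw [M, dirichlet_mul hm]
  have h1 : ∑ l ∈ Finset.range (m s), psi m (l * M m s) x
      = ∑ l ∈ Finset.range (m s), rademacher m s x ^ l :=
    Finset.sum_congr rfl fun l hl => psi_mul_M hm (Finset.mem_range.1 hl) x
  have h2 : rademacher m s x ≠ 1 := by
    rw [rademacher_eq_stdAddChar]
    intro h
    exact hx (ZMod.injective_stdAddChar (by rw [h, AddChar.map_zero_eq_one]))
  have h3 : rademacher m s x ^ m s = 1 := by
    rw [rademacher_eq_stdAddChar, ← AddChar.map_nsmul_eq_pow]; simp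
  rw [h1, geom_sum_eq h2, h3]
  simp

/-- Divide `k` by `M_{s+1}`: the multiple of `M_{s+1}` contributes a multiple of `D_{M_{s+1}}(x)`,
which vanishes, and the remainder has fewer than `M_{s+1}` unimodular terms. -/
theorem norm_dirichlet_le_of_ne_zero (hm : ∀ k, 2 ≤ m k) {s : ℕ} {x : G m} (hx : x s ≠ 0)
    (k : ℕ) : ‖dirichlet m k x‖ ≤ M m (s + 1) := by
  have hr : k % M m (s + 1) < M m (s + 1) := Nat.mod_lt _ (M_pos hm _)
  rw [← Nat.div_add_mod' k (M m (s + 1)), dirichlet_mul_add hm _ hr.le, dirichlet_mul hm,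
    dirichlet_M_succ_eq_zero hm hx, mul_zero, zero_add, norm_mul, norm_psi, one_mul]
  exact (norm_dirichlet_le _ _).trans (by exact_mod_cast hr.le)

/-- One term of the sum suffices: if `s` is the first coordinate where `x` and `t` differ, the
kernel is at most `M_{s+1} ≤ L * M_s`. If they agree in the first `n + 1` coordinates, the trivial
bound `k` is used. The sum over all scales makes the bound easy to integrate. -/
theorem norm_dirichlet_sub_le (hm : ∀ k, 2 ≤ m k) {L : ℕ} (hL : ∀ k, m k ≤ L) {k n : ℕ}
    (hk : k ≤ M m (n + 1)) (x t : G m) :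
    ‖dirichlet m k (x - t)‖
      ≤ L * ∑ s ∈ Finset.range (n + 2), (interval m s x).indicator (fun _ => (M m s : ℝ)) t := by
  classical
  have hterm : ∀ s < n + 2, t ∈ interval m s x → (M m s : ℝ) ≤
      ∑ s ∈ Finset.range (n + 2), (interval m s x).indicator (fun _ => (M m s : ℝ)) t := by
    intro s hs ht
    have h := Finset.single_le_sum (s := Finset.range (n + 2))
      (f := fun s => (interval m s x).indicator (fun _ => (M m s : ℝ)) t)
      (fun s _ => Set.indicator_nonneg (fun _ _ => Nat.cast_nonneg _) _) (Finset.mem_range.2 hs)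
    simpa [ht] using h
  have hL1 : (1 : ℝ) ≤ L := by exact_mod_cast (by have := hm 0; have := hL 0; omega : 1 ≤ L)
  by_cases hex : ∃ s, s < n + 1 ∧ x s ≠ t s
  · obtain ⟨hs, hne⟩ := Nat.find_spec hex
    set s := Nat.find hex
    have ht : t ∈ interval m s x := fun j hj => by
      have := Nat.find_min hex hj
      by_contra hj2
      exact this ⟨hj.trans hs, Ne.symm hj2⟩
    calc ‖dirichlet m k (x - t)‖ ≤ M m (s + 1) :=
          norm_dirichlet_le_of_ne_zero hm (by simpa [sub_eq_zero] using hne) k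
      _ = (m s : ℝ) * M m s := by rw [M]; push_cast; ring
      _ ≤ L * M m s := by gcongr; exact hL s
      _ ≤ _ := by gcongr; exact hterm s (by omega) ht
  · push Not at hex
    have ht : t ∈ interval m (n + 1) x := fun j hj => (hex j hj).symm
    calc ‖dirichlet m k (x - t)‖ ≤ k := norm_dirichlet_le _ _
      _ ≤ M m (n + 1) := by exact_mod_cast hk
      _ ≤ L * M m (n + 1) := le_mul_of_one_le_left (by positivity) hL1
      _ ≤ _ := by gcongr; exact hterm _ (by omega) ht

end Characters

/-! ### Powers with exponent below one and geometric series. -/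

section Powers

theorem rpow_le_rpow_of_nonpos {x y : ℝ≥0∞} {z : ℝ} (hxy : x ≤ y) (hz : z ≤ 0) :
    y ^ z ≤ x ^ z := by
  have h := ENNReal.inv_le_inv.2 (ENNReal.rpow_le_rpow hxy (neg_nonneg.2 hz))
  rwa [← ENNReal.rpow_neg, ← ENNReal.rpow_neg, neg_neg] at h

theorem sum_rpow_le {ι : Type*} {p : ℝ} (hp0 : 0 < p) (hp1 : p ≤ 1) (s : Finset ι)
    (f : ι → ℝ≥0∞) : (∑ i ∈ s, f i) ^ p ≤ ∑ i ∈ s, f i ^ p := by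
  classical
  induction s using Finset.induction_on with
  | empty => simp [hp0]
  | insert a s ha ih =>
    rw [Finset.sum_insert ha, Finset.sum_insert ha]
    exact (ENNReal.rpow_add_le_add_rpow _ _ hp0.le hp1).trans (by gcongr)

/-- The ratio `2 ^ (p - 1)`. -/
noncomputable def ratio (p : ℝ) : ℝ≥0∞ := 2 ^ (p - 1)

theorem ratio_lt_one {p : ℝ} (hp1 : p < 1) : ratio p < 1 :=
  ENNReal.rpow_lt_one_of_one_lt_of_neg (by norm_num) (by linarith)

theorem tsum_ratio_ne_top {p : ℝ} (hp1 : p < 1) : ∑' i : ℕ, ratio p ^ i ≠ ∞ := by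
  rw [ENNReal.tsum_geometric]
  exact ENNReal.inv_ne_top.2 (tsub_pos_of_lt (ratio_lt_one hp1)).ne'

theorem tsum_add_two_mul_ratio_ne_top {p : ℝ} (hp1 : p < 1) :
    ∑' i : ℕ, ((i + 2 : ℕ) : ℝ≥0∞) * ratio p ^ i ≠ ∞ := by
  have h := ratio_lt_one hp1
  lift ratio p to ℝ≥0 using h.ne_top with r
  have hr : (r : ℝ) < 1 := by exact_mod_cast h
  have h1 : Summable fun i : ℕ => ((i + 2 : ℕ) : ℝ≥0) * r ^ i := by
    rw [← NNReal.summable_coe]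
    have h2 := summable_pow_mul_geometric_of_norm_lt_one (R := ℝ) 1 (r := r) (by simpa using hr)
    have h3 := summable_geometric_of_lt_one r.coe_nonneg hr
    refine (h2.add (h3.mul_left 2)).congr fun i => ?_
    push_cast; ring
  have := ENNReal.tsum_coe_ne_top_iff_summable.2 h1
  simpa using this

variable {m : ℕ → ℕ}

theorem M_ne_zero (hm : ∀ k, 2 ≤ m k) (n : ℕ) : (M m n : ℝ≥0∞) ≠ 0 := by
  exact_mod_cast (M_pos hm n).ne'

theorem M_add_ge (hm : ∀ k, 2 ≤ m k) (N i : ℕ) : 2 ^ i * M m N ≤ M m (N + i) := by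
  induction i with
  | zero => simp
  | succ i ih =>
    rw [pow_succ, mul_comm (2 ^ i), mul_assoc, ← add_assoc, M]
    exact Nat.mul_le_mul (hm _) ih

theorem M_add_rpow_le (hm : ∀ k, 2 ≤ m k) {p : ℝ} (hp1 : p < 1) (N i : ℕ) :
    (M m (N + i) : ℝ≥0∞) ^ (p - 1) ≤ ratio p ^ i * (M m N : ℝ≥0∞) ^ (p - 1) := by
  have h : ((2 : ℝ≥0∞) ^ i * M m N) ≤ M m (N + i) := by exact_mod_cast M_add_ge hm N i
  refine (rpow_le_rpow_of_nonpos h (by linarith)).trans_eq ?_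
  rw [ENNReal.mul_rpow_of_ne_top (by simp) (by simp), ratio, ← ENNReal.rpow_natCast,
    ← ENNReal.rpow_natCast, ← ENNReal.rpow_mul, ← ENNReal.rpow_mul, mul_comm (i : ℝ)]

theorem sum_M_rpow_le (hm : ∀ k, 2 ≤ m k) {p : ℝ} (hp1 : p < 1) (N : ℕ) :
    ∑ s ∈ Finset.range N, (M m s : ℝ≥0∞) ^ (p - 1) ≤ ∑' i : ℕ, ratio p ^ i := by
  refine le_trans (Finset.sum_le_sum fun s _ => ?_) (ENNReal.sum_le_tsum (Finset.range N))
  simpa [M] using M_add_rpow_le hm hp1 0 s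

end Powers

/-! ### The weighted sum of an atom. -/

section Atoms

variable {m : ℕ → ℕ}

/-- The `k`-th partial sum of the Vilenkin-Fourier series of an integrable function. -/
noncomputable def fourierSum (g : G m → ℂ) (k : ℕ) (x : G m) : ℂ :=
  ∑ i ∈ Finset.range k, (∫ t, g t * starRingEnd ℂ (psi m i t) ∂(haar m)) * psi m i x

/-- The weighted sum of the `‖S_k g‖_p ^ p` over `1 ≤ k < M_K`. -/
noncomputable def weightedSum (p : ℝ) (K : ℕ) (g : G m → ℂ) : ℝ≥0∞ :=
  ∑ k ∈ Finset.Ico 1 (M m K), (∫⁻ x, ‖fourierSum g k x‖ₑ ^ p ∂(haar m)) / (k : ℝ≥0∞) ^ (2 - p)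

theorem dependsOnFirst_psi (hm : ∀ k, 2 ≤ m k) {i n : ℕ} (hi : i < M m n) :
    DependsOnFirst n (psi m i) := fun _ _ hy => psi_congr hm hi hy

theorem dependsOnFirst_fourierSum (hm : ∀ k, 2 ≤ m k) (g : G m → ℂ) (k : ℕ) :
    DependsOnFirst k (fourierSum g k) := fun x y hy =>
  Finset.sum_congr rfl fun i hi => by
    rw [psi_congr hm ((Finset.mem_range.1 hi).trans (lt_M hm k)) hy]

theorem DependsOnFirst.mul_conj_psi (hm : ∀ k, 2 ≤ m k) {K : ℕ} {g : G m → ℂ}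
    (hg : DependsOnFirst K g) (i : ℕ) :
    DependsOnFirst (max K i) (fun t => g t * starRingEnd ℂ (psi m i t)) := fun x y hy => by
  have h1 := hg (interval_anti (le_max_left K i) x hy)
  have h2 := psi_congr hm (lt_M hm i) (interval_anti (le_max_right K i) x hy)
  simp only [h1, h2]

theorem sum_Ico_M (hm : ∀ k, 2 ≤ m k) (K : ℕ) (F : ℕ → ℝ≥0∞) :
    ∑ k ∈ Finset.Ico 1 (M m K), F k
      = ∑ n ∈ Finset.range K, ∑ k ∈ Finset.Ico (M m n) (M m (n + 1)), F k := by
  induction K with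
  | zero => simp [M]
  | succ K ih =>
    rw [Finset.sum_range_succ, ← ih, Finset.sum_Ico_consecutive _ (M_pos hm K)
      (M_mono hm K.le_succ)]

/-- A block has at most `L * M_n` indices, each with weight at most `M_n ^ (p - 2)`. -/
theorem sum_block_le (hm : ∀ k, 2 ≤ m k) {L : ℕ} (hL : ∀ k, m k ≤ L) {p : ℝ} (hp1 : p < 1)
    (n : ℕ) (F : ℕ → ℝ≥0∞) (B : ℝ≥0∞)
    (hF : ∀ k ∈ Finset.Ico (M m n) (M m (n + 1)), F k ≤ B) :
    ∑ k ∈ Finset.Ico (M m n) (M m (n + 1)), F k / (k : ℝ≥0∞) ^ (2 - p)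
      ≤ L * B * (M m n : ℝ≥0∞) ^ (p - 1) := by
  have h1 : ∀ k ∈ Finset.Ico (M m n) (M m (n + 1)),
      F k / (k : ℝ≥0∞) ^ (2 - p) ≤ B / (M m n : ℝ≥0∞) ^ (2 - p) := fun k hk => by
    have hk2 : (M m n : ℝ≥0∞) ≤ k := by exact_mod_cast (Finset.mem_Ico.1 hk).1
    exact ENNReal.div_le_div (hF k hk) (ENNReal.rpow_le_rpow hk2 (by linarith))
  refine (Finset.sum_le_card_nsmul _ _ _ h1).trans ?_
  have hcard : ((Finset.Ico (M m n) (M m (n + 1))).card : ℝ≥0∞) ≤ L * M m n := by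
    rw [Nat.card_Ico, M]
    exact_mod_cast (Nat.sub_le _ _).trans (Nat.mul_le_mul_right _ (hL n))
  have hpow : (M m n : ℝ≥0∞) * ((M m n : ℝ≥0∞) ^ (2 - p))⁻¹ = (M m n : ℝ≥0∞) ^ (p - 1) := by
    rw [← ENNReal.rpow_neg]
    nth_rewrite 1 [← ENNReal.rpow_one (M m n : ℝ≥0∞)]
    rw [← ENNReal.rpow_add _ _ (M_ne_zero hm n) (ENNReal.natCast_ne_top _)]
    congr 1; ring
  rw [nsmul_eq_mul, div_eq_mul_inv]
  calc _ ≤ (L * M m n : ℝ≥0∞) * (B * ((M m n : ℝ≥0∞) ^ (2 - p))⁻¹) := by gcongr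
    _ = L * B * ((M m n : ℝ≥0∞) * ((M m n : ℝ≥0∞) ^ (2 - p))⁻¹) := by ring
    _ = _ := by rw [hpow]

variable [∀ k, NeZero (m k)]

/-- `S_k g` is the convolution of `g` with `D_k`. -/
theorem enorm_fourierSum_le_lintegral (hm : ∀ k, 2 ≤ m k) {K : ℕ} {g : G m → ℂ}
    (hg : DependsOnFirst K g) (k : ℕ) (x : G m) :
    ‖fourierSum g k x‖ₑ ≤ ∫⁻ t, ‖g t‖ₑ * ‖dirichlet m k (x - t)‖ₑ ∂(haar m) := by
  have h : fourierSum g k x = ∫ t, g t * dirichlet m k (x - t) ∂(haar m) := by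
    simp only [fourierSum, dirichlet, psi_sub, Finset.mul_sum]
    rw [integral_finsetSum]
    · refine Finset.sum_congr rfl fun i _ => ?_
      rw [← integral_mul_const]
      congr 1; funext t; ring
    · intro i _
      have := (hg.mul_conj_psi hm i).integrable.mul_const (psi m i x)
      refine this.congr (.of_forall fun t => ?_)
      simp only; ring
  rw [h]
  refine (enorm_integral_le_lintegral_enorm _).trans_eq ?_
  simp only [enorm_mul]

theorem enorm_dirichlet_sub_le (hm : ∀ k, 2 ≤ m k) {L : ℕ} (hL : ∀ k, m k ≤ L) {k n : ℕ}
    (hk : k ≤ M m (n + 1)) (x t : G m) :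
    ‖dirichlet m k (x - t)‖ₑ
      ≤ L * ∑ s ∈ Finset.range (n + 2), (interval m s x).indicator (fun _ => (M m s : ℝ≥0∞)) t := by
  have h := norm_dirichlet_sub_le hm hL hk x t
  rw [← ofReal_norm]
  refine (ENNReal.ofReal_le_ofReal h).trans_eq ?_
  rw [ENNReal.ofReal_mul (by positivity), ENNReal.ofReal_natCast, ENNReal.ofReal_sum_of_nonneg
    (fun s _ => Set.indicator_nonneg (fun _ _ => Nat.cast_nonneg _) _)]
  congr 1
  refine Finset.sum_congr rfl fun s _ => ?_
  by_cases ht : t ∈ interval m s x <;> simp [ht]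

/-- Integrate the kernel bound over `I_N(c)`. A scale `s < N` contributes at most `M_s / M_N`, and
only if `x ∈ I_s(c)`. Each of the `i + 2` scales from `N` to `N + i + 1` contributes at most `M_s *
μ(I_s(x)) = 1`, and only if `x ∈ I_N(c)`. -/
theorem enorm_fourierSum_le (hm : ∀ k, 2 ≤ m k) {L : ℕ} (hL : ∀ k, m k ≤ L) {K N i k : ℕ}
    {g : G m → ℂ} (hg : DependsOnFirst K g) {c : G m} {A : ℝ≥0∞}
    (hA : ∀ x, ‖g x‖ₑ ≤ (interval m N c).indicator (fun _ => A) x)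
    (hk : k ≤ M m (N + i + 1)) (x : G m) :
    ‖fourierSum g k x‖ₑ ≤ A * L *
      (∑ s ∈ Finset.range N,
          (interval m s c).indicator (fun _ => (M m s : ℝ≥0∞) * (M m N : ℝ≥0∞)⁻¹) x
        + (interval m N c).indicator (fun _ => ((i + 2 : ℕ) : ℝ≥0∞)) x) := by
  have hmeas : ∀ s, MeasurableSet (interval m N c ∩ interval m s x) := fun s =>
    (measurableSet_interval m N c).inter (measurableSet_interval m s x)
  have h1 : ‖fourierSum g k x‖ₑ ≤ A * L * ∑ s ∈ Finset.range (N + (i + 2)),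
      M m s * haar m (interval m N c ∩ interval m s x) := by
    refine (enorm_fourierSum_le_lintegral hm hg k x).trans ?_
    calc _ ≤ ∫⁻ t, A * L * ∑ s ∈ Finset.range (N + (i + 2)),
          (interval m N c ∩ interval m s x).indicator (fun _ => (M m s : ℝ≥0∞)) t ∂(haar m) := by
          refine lintegral_mono fun t => ?_
          refine (mul_le_mul' (hA t) (enorm_dirichlet_sub_le hm hL hk x t)).trans_eq ?_
          by_cases ht : t ∈ interval m N c
          · simp only [ht, Set.indicator_of_mem, mul_assoc, ← Set.indicator_indicator, add_assoc]
          · simp [ht]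
      _ = _ := by
          rw [lintegral_const_mul, lintegral_finsetSum]
          · simp only [lintegral_indicator_const (hmeas _)]
          · exact fun s _ => measurable_const.indicator (hmeas s)
          · exact Finset.measurable_sum _ fun s _ => measurable_const.indicator (hmeas s)
  refine h1.trans ?_
  rw [Finset.sum_range_add]
  gcongr with s hs
  · by_cases hx : x ∈ interval m s c
    · simp only [hx, Set.indicator_of_mem]
      gcongr
      rw [← haar_interval N c]
      exact measure_mono Set.inter_subset_left
    · have : interval m N c ∩ interval m s x = ∅ := by
        ext t
        simp only [Set.mem_inter_iff, Set.mem_empty_iff_false, iff_false, not_and]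
        intro h2 h3
        exact hx (mem_interval_trans (interval_anti (Finset.mem_range.1 hs).le c h2)
          (mem_interval_comm.1 h3))
      simp [this]
  · by_cases hx : x ∈ interval m N c
    · simp only [hx, Set.indicator_of_mem]
      have h2 : ∀ s ∈ Finset.range (i + 2),
          M m (N + s) * haar m (interval m N c ∩ interval m (N + s) x) ≤ 1 := fun s _ => by
        calc _ ≤ M m (N + s) * haar m (interval m (N + s) x) := by
              gcongr; exact Set.inter_subset_right
          _ = 1 := by
              rw [haar_interval, ENNReal.mul_inv_cancel (M_ne_zero hm _) (ENNReal.natCast_ne_top _)]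
      refine (Finset.sum_le_card_nsmul _ _ _ h2).trans ?_
      simp
    · have : ∀ s, interval m N c ∩ interval m (N + s) x = ∅ := fun s => by
        ext t
        simp only [Set.mem_inter_iff, Set.mem_empty_iff_false, iff_false, not_and]
        intro h2 h3
        exact hx (mem_interval_trans h2 (mem_interval_comm.1 (interval_anti (by omega) x h3)))
      simp [this]

/-- Off the support, scale `s` gives `(M_s / M_N) ^ p / M_s = M_N ^ (-p) * M_s ^ (p - 1)`, summable
in `s`; on the support, `M_N ^ (-1) ≤ M_N ^ (-p)`. -/
theorem lintegral_fourierSum_rpow_le (hm : ∀ k, 2 ≤ m k) {L : ℕ} (hL : ∀ k, m k ≤ L) {p : ℝ}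
    (hp0 : 0 < p) (hp1 : p < 1) {K N i k : ℕ} {g : G m → ℂ} (hg : DependsOnFirst K g) {c : G m}
    {A : ℝ≥0∞} (hA : ∀ x, ‖g x‖ₑ ≤ (interval m N c).indicator (fun _ => A) x)
    (hk : k ≤ M m (N + i + 1)) :
    ∫⁻ x, ‖fourierSum g k x‖ₑ ^ p ∂(haar m) ≤ (A * L) ^ p * (M m N : ℝ≥0∞) ^ (-p) *
      ((∑' i : ℕ, ratio p ^ i + 1) * ((i + 2 : ℕ) : ℝ≥0∞)) := by
  have hmeas : ∀ s, MeasurableSet (interval m s c) := fun s => measurableSet_interval m s c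
  have hone : (1 : ℝ≥0∞) ≤ ((i + 2 : ℕ) : ℝ≥0∞) := by exact_mod_cast (by omega : 1 ≤ i + 2)
  have hMM : ∀ s, (M m s : ℝ≥0∞) ^ p * (M m s : ℝ≥0∞)⁻¹ = (M m s : ℝ≥0∞) ^ (p - 1) := fun s => by
    rw [← ENNReal.rpow_neg_one, ← ENNReal.rpow_add _ _ (M_ne_zero hm s)
      (ENNReal.natCast_ne_top _), sub_eq_add_neg]
  calc _ ≤ ∫⁻ x, (A * L) ^ p *
      (∑ s ∈ Finset.range N, (interval m s c).indicator
          (fun _ => (M m s : ℝ≥0∞) ^ p * (M m N : ℝ≥0∞) ^ (-p)) x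
        + (interval m N c).indicator (fun _ => ((i + 2 : ℕ) : ℝ≥0∞)) x) ∂(haar m) := by
        refine lintegral_mono fun x => ?_
        refine (ENNReal.rpow_le_rpow (enorm_fourierSum_le hm hL hg hA hk x) hp0.le).trans ?_
        rw [ENNReal.mul_rpow_of_nonneg _ _ hp0.le]
        gcongr
        refine (ENNReal.rpow_add_le_add_rpow _ _ hp0.le hp1.le).trans ?_
        gcongr
        · refine (sum_rpow_le hp0 hp1.le _ _).trans (Finset.sum_le_sum fun s _ => ?_)
          by_cases hx : x ∈ interval m s c
          · simp only [hx, Set.indicator_of_mem]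
            rw [ENNReal.mul_rpow_of_nonneg _ _ hp0.le, ENNReal.inv_rpow, ENNReal.rpow_neg]
          · simp [hx, hp0]
        · by_cases hx : x ∈ interval m N c
          · simp only [hx, Set.indicator_of_mem]
            exact (ENNReal.rpow_le_rpow_of_exponent_le hone hp1.le).trans_eq (ENNReal.rpow_one _)
          · simp [hx, hp0]
    _ = (A * L) ^ p * ((∑ s ∈ Finset.range N, (M m s : ℝ≥0∞) ^ (p - 1)) * (M m N : ℝ≥0∞) ^ (-p)
          + ((i + 2 : ℕ) : ℝ≥0∞) * (M m N : ℝ≥0∞)⁻¹) := by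
        rw [lintegral_const_mul, lintegral_add_right, lintegral_finsetSum]
        · simp only [lintegral_indicator_const (hmeas _), haar_interval]
          rw [Finset.sum_mul]
          congr 2
          refine Finset.sum_congr rfl fun s _ => ?_
          rw [← hMM]; ring
        · exact fun s _ => measurable_const.indicator (hmeas s)
        · exact measurable_const.indicator (hmeas N)
        · exact (Finset.measurable_sum _ fun s _ => measurable_const.indicator (hmeas s)).add
            (measurable_const.indicator (hmeas N))
    _ ≤ (A * L) ^ p * ((∑' i : ℕ, ratio p ^ i) * (M m N : ℝ≥0∞) ^ (-p) * ((i + 2 : ℕ) : ℝ≥0∞)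
          + ((i + 2 : ℕ) : ℝ≥0∞) * (M m N : ℝ≥0∞) ^ (-p)) := by
        refine mul_le_mul_right (add_le_add ?_ (mul_le_mul_right ?_ _)) _
        · refine (mul_le_mul_left (sum_M_rpow_le hm hp1 N) _).trans ?_
          exact le_mul_of_one_le_right' hone
        · rw [← ENNReal.rpow_neg_one]
          exact ENNReal.rpow_le_rpow_of_exponent_le (by exact_mod_cast M_pos hm N) (by linarith)
    _ = _ := by ring

/-- The constant in the estimate for atoms. -/
noncomputable def atomConst (p : ℝ) (L : ℕ) : ℝ≥0∞ :=
  L * (L : ℝ≥0∞) ^ p * (∑' i : ℕ, ratio p ^ i + 1) *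
    ∑' i : ℕ, ((i + 2 : ℕ) : ℝ≥0∞) * ratio p ^ i

theorem atomConst_ne_top {p : ℝ} (hp0 : 0 < p) (hp1 : p < 1) (L : ℕ) : atomConst p L ≠ ∞ := by
  refine ENNReal.mul_ne_top (ENNReal.mul_ne_top (ENNReal.mul_ne_top (ENNReal.natCast_ne_top _) ?_)
    (ENNReal.add_ne_top.2 ⟨tsum_ratio_ne_top hp1, ENNReal.one_ne_top⟩))
    (tsum_add_two_mul_ratio_ne_top hp1)
  exact ENNReal.rpow_ne_top_of_nonneg hp0.le (ENNReal.natCast_ne_top _)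

/-- Blocks below `N` vanish by cancellation, and block `N + i` is at most a constant times `(i + 2)
* ratio p ^ i * A ^ p / M_N`. For `N = 0` there are no lower blocks, so no cancellation is required.
-/
theorem weightedSum_atom_le (hm : ∀ k, 2 ≤ m k) {L : ℕ} (hL : ∀ k, m k ≤ L) {p : ℝ}
    (hp0 : 0 < p) (hp1 : p < 1) {K N : ℕ} {g : G m → ℂ} (hg : DependsOnFirst K g) {c : G m}
    {A : ℝ≥0∞} (hA : ∀ x, ‖g x‖ₑ ≤ (interval m N c).indicator (fun _ => A) x)
    (hcancel : N ≠ 0 → ∀ i < M m N, ∫ t, g t * starRingEnd ℂ (psi m i t) ∂(haar m) = 0) (K' : ℕ) :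
    weightedSum p K' g ≤ atomConst p L * A ^ p * (M m N : ℝ≥0∞)⁻¹ := by
  set F : ℕ → ℝ≥0∞ := fun n => ∑ k ∈ Finset.Ico (M m n) (M m (n + 1)),
    (∫⁻ x, ‖fourierSum g k x‖ₑ ^ p ∂(haar m)) / (k : ℝ≥0∞) ^ (2 - p) with hF
  have hlow : ∀ n < N, F n = 0 := fun n hn => by
    refine Finset.sum_eq_zero fun k hk => ?_
    have h0 : ∀ x, fourierSum g k x = 0 := fun x => Finset.sum_eq_zero fun i hi => by
      rw [hcancel (by omega) i, zero_mul]
      exact (Finset.mem_range.1 hi).trans_le ((Finset.mem_Ico.1 hk).2.le.trans (M_mono hm hn))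
    simp [h0, hp0]
  set B : ℝ≥0∞ := (A * L) ^ p * (∑' i : ℕ, ratio p ^ i + 1) with hB
  have hhigh : ∀ i, F (N + i)
      ≤ L * B * (M m N : ℝ≥0∞)⁻¹ * (((i + 2 : ℕ) : ℝ≥0∞) * ratio p ^ i) := fun i => by
    have hMM : (M m N : ℝ≥0∞) ^ (-p) * (M m N : ℝ≥0∞) ^ (p - 1) = (M m N : ℝ≥0∞)⁻¹ := by
      rw [← ENNReal.rpow_add _ _ (M_ne_zero hm N) (ENNReal.natCast_ne_top _),
        ← ENNReal.rpow_neg_one]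
      congr 1; ring
    refine (sum_block_le hm hL hp1 (N + i) _ _ fun k hk =>
      lintegral_fourierSum_rpow_le hm hL hp0 hp1 hg hA (Finset.mem_Ico.1 hk).2.le).trans ?_
    refine (mul_le_mul_right (M_add_rpow_le hm hp1 N i) _).trans_eq ?_
    rw [← hMM, hB]
    ring
  calc weightedSum p K' g = ∑ n ∈ Finset.range K', F n := sum_Ico_M hm K' _
    _ ≤ ∑ n ∈ Finset.range (N + K'), F n :=
        Finset.sum_le_sum_of_subset (Finset.range_mono (by omega))
    _ = ∑ i ∈ Finset.range K', F (N + i) := by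
        rw [Finset.sum_range_add, Finset.sum_eq_zero fun n hn => hlow n (Finset.mem_range.1 hn),
          zero_add]
    _ ≤ ∑ i ∈ Finset.range K',
          L * B * (M m N : ℝ≥0∞)⁻¹ * (((i + 2 : ℕ) : ℝ≥0∞) * ratio p ^ i) :=
        Finset.sum_le_sum fun i _ => hhigh i
    _ ≤ L * B * (M m N : ℝ≥0∞)⁻¹ * ∑' i : ℕ, ((i + 2 : ℕ) : ℝ≥0∞) * ratio p ^ i := by
        rw [← Finset.mul_sum]
        gcongr
        exact ENNReal.sum_le_tsum _
    _ = _ := by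
        rw [hB, atomConst, ENNReal.mul_rpow_of_nonneg _ _ hp0.le]
        ring

theorem weightedSum_sum_le (hm : ∀ k, 2 ≤ m k) {p : ℝ} (hp0 : 0 < p) (hp1 : p < 1) {K : ℕ}
    {ι : Type*} (s : Finset ι) (g : ι → G m → ℂ) (hg : ∀ i ∈ s, DependsOnFirst K (g i)) (K' : ℕ) :
    weightedSum p K' (fun x => ∑ i ∈ s, g i x) ≤ ∑ i ∈ s, weightedSum p K' (g i) := by
  have hlin : ∀ k x, fourierSum (fun x => ∑ i ∈ s, g i x) k x = ∑ i ∈ s, fourierSum (g i) k x := by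
    intro k x
    simp only [fourierSum, Finset.sum_mul]
    rw [Finset.sum_comm]
    refine Finset.sum_congr rfl fun l _ => ?_
    rw [integral_finsetSum _ fun i hi => ((hg i hi).mul_conj_psi hm l).integrable, Finset.sum_mul]
  simp only [weightedSum]
  rw [Finset.sum_comm]
  refine Finset.sum_le_sum fun k _ => ?_
  simp only [div_eq_mul_inv]
  rw [← Finset.sum_mul, ← lintegral_finsetSum]
  · gcongr with x
    rw [hlin]
    refine (ENNReal.rpow_le_rpow (enorm_sum_le _ _) hp0.le).trans ?_
    exact sum_rpow_le hp0 hp1.le _ _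
  · intro i _
    exact (dependsOnFirst_fourierSum hm (g i) k).measurable.enorm.pow_const p

end Atoms

/-! ### Martingales as functions constant on intervals, and their coefficients. -/

section Martingales

variable {m : ℕ → ℕ}

theorem mem_iff_of_measurableSet_sigmaAlg {n : ℕ} {s : Set (G m)}
    (hs : MeasurableSet[sigmaAlg m n] s) {x y : G m} (hy : y ∈ interval m n x) :
    y ∈ s ↔ x ∈ s := by
  induction s, hs using MeasurableSpace.generateFrom_induction with
  | hC t ht _ =>
    obtain ⟨c, rfl⟩ := ht
    exact iff_of_eq (dependsOnFirst_mem_interval n c hy)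
  | empty => simp
  | compl t _ ih => simpa using not_congr ih
  | iUnion t _ ih => simp only [Set.mem_iUnion, ih]

theorem measurableSet_sigmaAlg_interval (n : ℕ) (x : G m) :
    MeasurableSet[sigmaAlg m n] (interval m n x) :=
  MeasurableSpace.measurableSet_generateFrom ⟨x, rfl⟩

variable {f : ℕ → G m → ℂ}

/-- Every set of `F_n` is a union of intervals of length `n`; applied to the level sets of `f_n`,
this holds at every point, not just almost everywhere. -/
theorem dependsOnFirst_of_martingale (hf : Martingale f (filtration m) (haar m)) (n : ℕ) :
    DependsOnFirst n (f n) := fun x y hy => by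
  have h1 : Measurable[sigmaAlg m n] (f n) := (hf.1 n).measurable
  have h2 : MeasurableSet[sigmaAlg m n] (f n ⁻¹' {f n x}) := h1 (measurableSet_singleton _)
  exact (mem_iff_of_measurableSet_sigmaAlg h2 hy).2 rfl

variable [∀ k, NeZero (m k)]

/-- `h` takes a constant value on each of the finitely many intervals of length `n`, over which the
increment has integral zero. -/
theorem integral_sub_mul_eq_zero (hf : Martingale f (filtration m) (haar m)) {n : ℕ} {h : G m → ℂ}
    (hh : DependsOnFirst n h) : ∫ x, (f (n + 1) x - f n x) * h x ∂(haar m) = 0 := by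
  classical
  have hint : Integrable (fun x => f (n + 1) x - f n x) (haar m) :=
    (hf.integrable (n + 1)).sub (hf.integrable n)
  have h1 : ∀ x, (f (n + 1) x - f n x) * h x = ∑ q : Cube m n,
      (interval m n q.center).indicator (fun x => f (n + 1) x - f n x) x * h q.center := by
    intro x
    rw [Finset.sum_eq_single (trunc n x)]
    · rw [Set.indicator_of_mem (mem_interval_center.2 rfl), hh.apply_center]
    · intro q _ hq
      rw [Set.indicator_of_notMem (fun hx => hq (mem_interval_center.1 hx).symm), zero_mul]
    · simp
  simp only [h1]
  rw [integral_finsetSum _ fun q _ => (hint.indicator (measurableSet_interval m n _)).mul_const _]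
  refine Finset.sum_eq_zero fun q _ => ?_
  rw [integral_mul_const, integral_indicator (measurableSet_interval m n _),
    integral_sub (hf.integrable (n + 1)).integrableOn (hf.integrable n).integrableOn,
    hf.setIntegral_eq n.le_succ (measurableSet_sigmaAlg_interval n q.center), sub_self, zero_mul]

theorem integral_mul_eq_of_le (hf : Martingale f (filtration m) (haar m)) {n K : ℕ} (hnK : n ≤ K)
    {h : G m → ℂ} (hh : DependsOnFirst n h) :
    ∫ x, f K x * h x ∂(haar m) = ∫ x, f n x * h x ∂(haar m) := by
  have hint : ∀ k ≥ n, Integrable (fun x => f k x * h x) (haar m) := fun k hk =>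
    DependsOnFirst.integrable (n := k) fun x y hy => by
      rw [dependsOnFirst_of_martingale hf k hy, hh.mono hk hy]
  induction K, hnK using Nat.le_induction with
  | base => rfl
  | succ K hK ih =>
    rw [← ih, ← sub_eq_zero, ← integral_sub (hint _ (by omega)) (hint _ hK)]
    simp only [← sub_mul]
    exact integral_sub_mul_eq_zero hf (hh.mono hK)

theorem fourierCoeff_eq_integral (hm : ∀ k, 2 ≤ m k)
    (hf : Martingale f (filtration m) (haar m)) {i K : ℕ} (hi : i < M m K) :
    fourierCoeff f i = ∫ x, f K x * starRingEnd ℂ (psi m i x) ∂(haar m) := by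
  have hdep : DependsOnFirst K fun x => starRingEnd ℂ (psi m i x) :=
    (dependsOnFirst_psi hm hi).comp _
  refine Tendsto.limUnder_eq (tendsto_const_nhds.congr' ?_)
  filter_upwards [eventually_ge_atTop K] with k hk
  exact (integral_mul_eq_of_le hf hk hdep).symm

theorem partialSum_eq_fourierSum (hm : ∀ k, 2 ≤ m k)
    (hf : Martingale f (filtration m) (haar m)) {k K : ℕ} (hk : k ≤ M m K) :
    partialSum f k = fourierSum (f K) k := by
  funext x
  exact Finset.sum_congr rfl fun i hi => by
    rw [fourierCoeff_eq_integral hm hf ((Finset.mem_range.1 hi).trans_le hk)]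

end Martingales

/-! ### Predictable stopping and the atomic decomposition of a layer. -/

section Stopping

open scoped Classical in
/-- The martingale `f` up to time `K`, stopped at the first `n` with `¬ P n`. -/
noncomputable def stopped {m : ℕ → ℕ} (f : ℕ → G m → ℂ) (P : ℕ → G m → Prop) (K : ℕ)
    (x : G m) : ℂ :=
  f 0 x + ∑ n ∈ Finset.range K, if P n x then f (n + 1) x - f n x else 0

variable {m : ℕ → ℕ}

/-- The predictable condition that `f` stays bounded by `a` up to and including time `n + 1`. -/
def Below (f : ℕ → G m → ℂ) (a : ℝ) (n : ℕ) (x : G m) : Prop :=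
  ∀ i ≤ n, ‖f i x‖ ≤ a ∧ ∀ y ∈ interval m i x, ‖f (i + 1) y‖ ≤ a

variable {f : ℕ → G m → ℂ}

theorem Below.anti {a : ℝ} {n l : ℕ} {x : G m} (h : Below f a n x) (hl : l ≤ n) :
    Below f a l x := fun i hi => h i (hi.trans hl)

theorem Below.mono {a b : ℝ} {n : ℕ} {x : G m} (h : Below f a n x) (hab : a ≤ b) :
    Below f b n x := fun i hi => ⟨(h i hi).1.trans hab, fun y hy => ((h i hi).2 y hy).trans hab⟩

/-- Testing `f (i + 1)` on all of `I_i(x)`, and not only at `x`, is what makes the condition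
predictable. -/
theorem dependsOnFirst_below (hf : ∀ n, DependsOnFirst n (f n)) (a : ℝ) (n : ℕ) :
    DependsOnFirst n (Below f a n) := by
  have key : ∀ x y, y ∈ interval m n x → Below f a n x → Below f a n y := by
    intro x y hy h i hi
    have hyi := interval_anti hi x hy
    exact ⟨by rw [hf i hyi]; exact (h i hi).1, fun z hz => (h i hi).2 z (mem_interval_trans hyi hz)⟩
  exact fun x y hy => propext ⟨key y x (mem_interval_comm.1 hy), key x y hy⟩

theorem stopped_eq {a : ℝ} {K : ℕ} {x : G m} (h : ∀ n < K, Below f a n x) :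
    stopped f (Below f a) K x = f K x := by
  rw [stopped, Finset.sum_congr rfl fun n hn => if_pos (h n (Finset.mem_range.1 hn)),
    Finset.sum_range_sub (fun n => f n x)]
  ring

/-- No overshoot occurs: an increment is added only when the next value is already known to stay
within the level. -/
theorem norm_stopped_le {a : ℝ} {x : G m} (h0 : ‖f 0 x‖ ≤ a) (K : ℕ) :
    ‖stopped f (Below f a) K x‖ ≤ a := by
  induction K with
  | zero => simpa [stopped] using h0
  | succ K ih =>
    by_cases hK : Below f a K x
    · rw [stopped_eq fun n hn => hK.anti (Nat.lt_succ_iff.1 hn)]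
      exact (hK K le_rfl).2 x (mem_interval_self K x)
    · have : stopped f (Below f a) (K + 1) x = stopped f (Below f a) K x := by
        rw [stopped, Finset.sum_range_succ, if_neg hK, add_zero, stopped]
      rwa [this]

theorem dependsOnFirst_stopped (hf : ∀ n, DependsOnFirst n (f n)) (a : ℝ) (K : ℕ) :
    DependsOnFirst K (stopped f (Below f a) K) := fun x y hy => by
  rw [stopped, stopped, hf 0 (mem_interval_zero x y)]
  congr 1
  refine Finset.sum_congr rfl fun n hn => ?_
  have hn' := Finset.mem_range.1 hn
  rw [dependsOnFirst_below hf a n (interval_anti hn'.le x hy), hf n (interval_anti hn'.le x hy),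
    hf (n + 1) (interval_anti hn' x hy)]

/-- The part of `f` between two levels. -/
noncomputable def layer (f : ℕ → G m → ℂ) (a b : ℝ) (K : ℕ) (x : G m) : ℂ :=
  stopped f (Below f b) K x - stopped f (Below f a) K x

/-- The predictable stopping time of the level `a` is equal to `n`. -/
def FirstExit (f : ℕ → G m → ℂ) (a : ℝ) (n : ℕ) (x : G m) : Prop :=
  ¬ Below f a n x ∧ ∀ l < n, Below f a l x

theorem dependsOnFirst_firstExit (hf : ∀ n, DependsOnFirst n (f n)) (a : ℝ) (n : ℕ) :
    DependsOnFirst n (FirstExit f a n) := fun x y hy => by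
  have h : ∀ l ≤ n, Below f a l y = Below f a l x := fun l hl =>
    dependsOnFirst_below hf a l (interval_anti hl x hy)
  rw [FirstExit, FirstExit, h n le_rfl]
  exact propext (and_congr_right fun _ => forall₂_congr fun l hl => by rw [h l hl.le])

theorem FirstExit.unique {a : ℝ} {n l : ℕ} {x : G m} (hn : FirstExit f a n x)
    (hl : FirstExit f a l x) : n = l := by
  rcases lt_trichotomy n l with h | h | h
  · exact absurd (hl.2 n h) hn.1
  · exact h
  · exact absurd (hn.2 l h) hl.1

open scoped Classical in
/-- The part of a layer that starts at time `n` on one interval. -/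
noncomputable def atom (f : ℕ → G m → ℂ) (a b : ℝ) (K n : ℕ) (c : G m) (x : G m) : ℂ :=
  if x ∈ interval m n c ∧ FirstExit f a n x then layer f a b K x else 0

theorem layer_eq_sum {a b : ℝ} (hab : a ≤ b) (K : ℕ) (x : G m) [DecidablePred fun n =>
    Below f b n x ∧ ¬ Below f a n x] :
    layer f a b K x = ∑ n ∈ Finset.range K,
      if Below f b n x ∧ ¬ Below f a n x then f (n + 1) x - f n x else 0 := by
  rw [layer, stopped, stopped, add_sub_add_left_eq_sub, ← Finset.sum_sub_distrib]
  refine Finset.sum_congr rfl fun n _ => ?_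
  by_cases h1 : Below f a n x
  · simp [h1, h1.mono hab]
  · by_cases h2 : Below f b n x <;> simp [h1, h2]

theorem dependsOnFirst_atom (hf : ∀ n, DependsOnFirst n (f n)) (a b : ℝ) {K n : ℕ} (hn : n ≤ K)
    (c : G m) : DependsOnFirst K (atom f a b K n c) := fun x y hy => by
  have hy' := interval_anti hn x hy
  have h1 : (y ∈ interval m n c) = (x ∈ interval m n c) := dependsOnFirst_mem_interval n c hy'
  classical
  simp only [atom, layer, dependsOnFirst_stopped hf a K hy, dependsOnFirst_stopped hf b K hy]
  exact if_congr (iff_of_eq (by rw [h1, dependsOnFirst_firstExit hf a n hy'])) rfl rfl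

theorem enorm_atom_le {a b : ℝ} (hab : a ≤ b) (h0 : ∀ x, ‖f 0 x‖ ≤ a) (K n : ℕ) (c x : G m) :
    ‖atom f a b K n c x‖ₑ
      ≤ (interval m n c).indicator (fun _ => ENNReal.ofReal (2 * b)) x := by
  classical
  by_cases hx : x ∈ interval m n c
  · rw [Set.indicator_of_mem hx, ← ofReal_norm]
    apply ENNReal.ofReal_le_ofReal
    have hb : 0 ≤ b := (norm_nonneg _).trans ((h0 x).trans hab)
    rw [atom]
    split_ifs
    · refine (norm_sub_le _ _).trans ?_
      linarith [norm_stopped_le ((h0 x).trans hab) K, norm_stopped_le (h0 x) K]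
    · simpa using hb
  · simp [atom, hx]

theorem measurable_maximalFunction (hf : ∀ n, DependsOnFirst n (f n)) :
    Measurable (maximalFunction f) :=
  Measurable.iSup fun n => (hf n).measurable.enorm

variable [∀ k, NeZero (m k)]

/-- Exit times are unique and the intervals of each length partition the group, so at most one atom
is nonzero at `x`. Without an exit before `K`, the layer itself vanishes at `x`. -/
theorem sum_atom_eq {a b : ℝ} (hab : a ≤ b) (K : ℕ) (x : G m) :
    ∑ n ∈ Finset.range K, ∑ q : Cube m n, atom f a b K n q.center x = layer f a b K x := by
  classical
  have h1 : ∀ n, ∑ q : Cube m n, atom f a b K n q.center x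
      = if FirstExit f a n x then layer f a b K x else 0 := fun n => by
    rw [Finset.sum_eq_single (trunc n x)]
    · simp [atom, mem_interval_center]
    · intro q _ hq
      rw [atom, if_neg]
      exact fun h => hq (mem_interval_center.1 h.1).symm
    · simp
  simp only [h1]
  by_cases hex : ∃ n, ¬ Below f a n x
  · have hfirst : FirstExit f a (Nat.find hex) x :=
      ⟨Nat.find_spec hex, fun l hl => not_not.1 (Nat.find_min hex hl)⟩
    have h2 : ∀ n, FirstExit f a n x ↔ n = Nat.find hex := fun n =>
      ⟨fun h => h.unique hfirst, fun h => h ▸ hfirst⟩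
    simp only [h2, Finset.sum_ite_eq', Finset.mem_range]
    split_ifs with h3
    · rfl
    · rw [layer_eq_sum hab]
      symm
      refine Finset.sum_eq_zero fun n hn => if_neg fun h => h.2 (hfirst.2 n ?_)
      have := Finset.mem_range.1 hn
      omega
  · push Not at hex
    simp [FirstExit, hex, layer_eq_sum hab]

/-- On the exit set at time `n` only increments with `l ≥ n` survive in the layer, and `ψ_i` with `i
< M_n` is already determined at time `n`. Each increment is thus integrated against a function of
the first `l` coordinates. -/
theorem integral_atom_eq_zero (hm : ∀ k, 2 ≤ m k) (hf : Martingale f (filtration m) (haar m))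
    {a b : ℝ} (hab : a ≤ b) (K : ℕ) {n i : ℕ} (hi : i < M m n) (c : G m) :
    ∫ x, atom f a b K n c x * starRingEnd ℂ (psi m i x) ∂(haar m) = 0 := by
  classical
  have hdep := dependsOnFirst_of_martingale hf
  set H : ℕ → G m → ℂ := fun l x =>
    if (x ∈ interval m n c ∧ FirstExit f a n x) ∧ Below f b l x ∧ ¬ Below f a l x
      then starRingEnd ℂ (psi m i x) else 0 with hH
  have hHdep : ∀ l ≥ n, DependsOnFirst l (H l) := fun l hl x y hy => by
    have hy' := interval_anti hl x hy
    have h1 : (y ∈ interval m n c) = (x ∈ interval m n c) := dependsOnFirst_mem_interval n c hy'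
    simp only [hH, h1, dependsOnFirst_firstExit hdep a n hy', dependsOnFirst_below hdep a l hy,
      dependsOnFirst_below hdep b l hy, psi_congr hm hi hy']
  have hHzero : ∀ l < n, H l = 0 := fun l hl => by
    funext x
    exact if_neg fun h => h.2.2 (h.1.2.2 l hl)
  have h1 : ∀ x, atom f a b K n c x * starRingEnd ℂ (psi m i x)
      = ∑ l ∈ Finset.range K, (f (l + 1) x - f l x) * H l x := fun x => by
    by_cases hx : x ∈ interval m n c ∧ FirstExit f a n x
    · rw [atom, if_pos hx, layer_eq_sum hab, Finset.sum_mul]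
      refine Finset.sum_congr rfl fun l _ => ?_
      by_cases h2 : Below f b l x ∧ ¬ Below f a l x
      · simp only [hH]; rw [if_pos h2, if_pos ⟨hx, h2⟩]
      · simp only [hH]; rw [if_neg h2, if_neg fun h => h2 h.2, zero_mul, mul_zero]
    · rw [atom, if_neg hx, zero_mul]
      symm
      refine Finset.sum_eq_zero fun l _ => ?_
      simp only [hH]
      rw [if_neg fun h => hx h.1, mul_zero]
  simp only [h1]
  rw [integral_finsetSum]
  · refine Finset.sum_eq_zero fun l _ => ?_
    rcases lt_or_ge l n with hl | hl
    · simp [hHzero l hl]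
    · exact integral_sub_mul_eq_zero hf (hHdep l hl)
  · intro l _
    rcases lt_or_ge l n with hl | hl
    · simp [hHzero l hl]
    · exact DependsOnFirst.integrable (n := l + 1) fun x y hy => by
        simp only [hdep (l + 1) hy, hdep l (interval_anti l.le_succ x hy),
          hHdep l hl (interval_anti l.le_succ x hy)]

/-- Exit at time `n` means that `‖f‖ > a` somewhere in the interval at time `n` or `n + 1`, hence on
a whole child interval. The child fills a fraction `1 / m_n ≥ 1 / L`, and the exit set contains the
entire parent. -/
theorem inv_M_le_of_firstExit {L : ℕ} (hL : ∀ k, m k ≤ L)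
    (hf : ∀ n, DependsOnFirst n (f n)) {a : ℝ} (ha : 0 ≤ a) {n : ℕ} {c x : G m}
    (hx : x ∈ interval m n c) (hexit : FirstExit f a n x) :
    (M m n : ℝ≥0∞)⁻¹ ≤ L * haar m
      (interval m n c ∩ ({x | FirstExit f a n x} ∩ {x | ENNReal.ofReal a < maximalFunction f x})) := by
  have hmax : ∀ l z, a < ‖f l z‖ → ENNReal.ofReal a < maximalFunction f z := fun l z h => by
    refine lt_of_lt_of_le ?_ (le_iSup (fun n => ‖f n z‖ₑ) l)
    rw [← ofReal_norm]
    exact (ENNReal.ofReal_lt_ofReal_iff_of_nonneg ha).2 h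
  obtain ⟨y, hy, hy2⟩ : ∃ y ∈ interval m n x, ∀ z ∈ interval m (n + 1) y,
      ENNReal.ofReal a < maximalFunction f z := by
    have h1 := hexit.1
    simp only [Below, not_forall, not_and_or] at h1
    obtain ⟨i, hi, h1⟩ := h1
    -- A failure at an earlier index would have been an earlier exit.
    have hin : i = n := by
      by_contra hne
      have h2 := hexit.2 i (by omega) i le_rfl
      rcases h1 with h1 | ⟨y, hy, h1⟩
      · exact h1 h2.1
      · exact h1 (h2.2 y hy)
    subst hin
    rcases h1 with h1 | ⟨y, hy, h1⟩
    · refine ⟨x, mem_interval_self _ _, fun z hz => hmax i z ?_⟩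
      rw [hf i (interval_anti i.le_succ x hz)]
      exact not_le.1 h1
    · refine ⟨y, hy, fun z hz => hmax (i + 1) z ?_⟩
      rw [hf (i + 1) hz]
      exact not_le.1 h1
  have hsub : interval m (n + 1) y ⊆ interval m n c ∩
      ({x | FirstExit f a n x} ∩ {x | ENNReal.ofReal a < maximalFunction f x}) := fun z hz => by
    have hzx : z ∈ interval m n x := mem_interval_trans hy (interval_anti n.le_succ y hz)
    refine ⟨mem_interval_trans hx hzx, ?_, hy2 z hz⟩
    change FirstExit f a n z
    rw [dependsOnFirst_firstExit hf a n hzx]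
    exact hexit
  refine le_trans ?_ (mul_le_mul_right (measure_mono hsub) _)
  rw [haar_interval, M, Nat.cast_mul, ENNReal.mul_inv (by simp) (by simp), ← mul_assoc]
  refine le_mul_of_one_le_left' ?_
  have hmn : (m n : ℝ≥0∞) ≠ 0 := by exact_mod_cast NeZero.ne (m n)
  rw [← ENNReal.mul_inv_cancel hmn (ENNReal.natCast_ne_top _)]
  gcongr
  exact hL n

theorem sum_measure_interval_inter_le (n : ℕ) {s : Set (G m)} (hs : MeasurableSet s) :
    ∑ q : Cube m n, haar m (interval m n q.center ∩ s) ≤ haar m s := by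
  rw [← measure_biUnion_finset]
  · exact measure_mono (Set.iUnion₂_subset fun _ _ => Set.inter_subset_right)
  · intro q _ r _ hqr
    refine Set.disjoint_left.2 fun x hx hx' => hqr ?_
    rw [← mem_interval_center.1 hx.1, ← mem_interval_center.1 hx'.1]
  · exact fun q _ => (measurableSet_interval m n _).inter hs

theorem weightedSum_layer_le (hm : ∀ k, 2 ≤ m k) {L : ℕ} (hL : ∀ k, m k ≤ L) {p : ℝ}
    (hp0 : 0 < p) (hp1 : p < 1) (hf : Martingale f (filtration m) (haar m)) {a b : ℝ} (ha : 0 ≤ a)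
    (hab : a ≤ b) (h0 : ∀ x, ‖f 0 x‖ ≤ a) (K : ℕ) :
    weightedSum p K (layer f a b K) ≤ atomConst p L * ENNReal.ofReal (2 * b) ^ p * L *
      haar m {x | ENNReal.ofReal a < maximalFunction f x} := by
  have hdep := dependsOnFirst_of_martingale hf
  set B : Set (G m) := {x | ENNReal.ofReal a < maximalFunction f x} with hB
  set C : ℝ≥0∞ := atomConst p L * ENNReal.ofReal (2 * b) ^ p with hC
  have hBm : MeasurableSet B := measurableSet_lt measurable_const (measurable_maximalFunction hdep)
  have hEm : ∀ n, MeasurableSet {x | FirstExit f a n x} := fun n =>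
    measurableSet_setOfPred.2 (dependsOnFirst_firstExit hdep a n).measurable
  have hatom : ∀ n (c : G m), n ≤ K → weightedSum p K (atom f a b K n c)
      ≤ C * L * haar m (interval m n c ∩ ({x | FirstExit f a n x} ∩ B)) := by
    intro n c hn
    by_cases hact : ∃ x ∈ interval m n c, FirstExit f a n x
    · obtain ⟨x, hx, hexit⟩ := hact
      refine (weightedSum_atom_le hm hL hp0 hp1 (dependsOnFirst_atom hdep a b hn c)
        (enorm_atom_le hab h0 K n c)
        (fun _ i hi => integral_atom_eq_zero hm hf hab K hi c) K).trans ?_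
      rw [mul_assoc C]
      exact mul_le_mul_right (inv_M_le_of_firstExit hL hdep ha hx hexit) _
    · have hzero : atom f a b K n c = 0 := funext fun x =>
        if_neg fun h => hact ⟨x, h.1, h.2⟩
      simp [hzero, weightedSum, fourierSum, hp0]
  have hlayer : layer f a b K
      = fun x => ∑ n ∈ Finset.range K, ∑ q : Cube m n, atom f a b K n q.center x :=
    funext fun x => (sum_atom_eq hab K x).symm
  have hsum : ∀ n ∈ Finset.range K,
      DependsOnFirst K (fun x => ∑ q : Cube m n, atom f a b K n q.center x) :=
    fun n hn x y hy => Finset.sum_congr rfl fun q _ =>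
      dependsOnFirst_atom hdep a b (Finset.mem_range.1 hn).le q.center hy
  calc weightedSum p K (layer f a b K) ≤ ∑ n ∈ Finset.range K,
          weightedSum p K (fun x => ∑ q : Cube m n, atom f a b K n q.center x) := by
        rw [hlayer]
        exact weightedSum_sum_le hm hp0 hp1 (Finset.range K)
          (fun n x => ∑ q : Cube m n, atom f a b K n q.center x) hsum K
    _ ≤ ∑ n ∈ Finset.range K, ∑ q : Cube m n, weightedSum p K (atom f a b K n q.center) :=
        Finset.sum_le_sum fun n hn => weightedSum_sum_le hm hp0 hp1 Finset.univ
          (fun (q : Cube m n) => atom f a b K n q.center) (fun q _ =>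
          dependsOnFirst_atom hdep a b (Finset.mem_range.1 hn).le q.center) K
    _ ≤ ∑ n ∈ Finset.range K, ∑ q : Cube m n,
          C * L * haar m (interval m n q.center ∩ ({x | FirstExit f a n x} ∩ B)) :=
        Finset.sum_le_sum fun n hn => Finset.sum_le_sum fun q _ =>
          hatom n _ (Finset.mem_range.1 hn).le
    _ ≤ ∑ n ∈ Finset.range K, C * L * haar m ({x | FirstExit f a n x} ∩ B) := by
        refine Finset.sum_le_sum fun n _ => ?_
        rw [← Finset.mul_sum]
        exact mul_le_mul_right (sum_measure_interval_inter_le n ((hEm n).inter hBm)) _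
    _ ≤ C * L * haar m B := by
        rw [← Finset.mul_sum, ← measure_biUnion_finset]
        · exact mul_le_mul_right
            (measure_mono (Set.iUnion₂_subset fun _ _ => Set.inter_subset_right)) _
        · intro n _ l _ hnl
          exact Set.disjoint_left.2 fun x hx hx' => hnl (FirstExit.unique hx.1 hx'.1)
        · exact fun n _ => (hEm n).inter hBm

end Stopping

/-! ### Summation over the levels and passage to the infinite series. -/

section Assembly

theorem sum_two_pow_mul_rpow_le {p : ℝ} (hp0 : 0 < p) (t : ℝ≥0∞) (J : ℕ) :
    ∑ j ∈ Finset.range (J + 1), (2 ^ j * t) ^ p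
      ≤ (∑' i : ℕ, ((2 : ℝ≥0∞) ^ (-p)) ^ i) * (2 ^ J * t) ^ p := by
  set σ : ℝ≥0∞ := 2 ^ (-p) with hσ
  have hstep : ∀ J : ℕ, (2 ^ J * t) ^ p = σ * (2 ^ (J + 1) * t) ^ p := fun J => by
    have h2 : σ * 2 ^ p = 1 := by
      rw [hσ, ← ENNReal.rpow_add _ _ (by simp) (by simp)]; simp
    rw [pow_succ', mul_assoc, ENNReal.mul_rpow_of_nonneg 2 _ hp0.le, ← mul_assoc, h2, one_mul]
  -- The geometric constant `S` satisfies `S = S * σ + 1`, exactly what the induction reproduces.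
  have hsum : ∑' i : ℕ, σ ^ i = (∑' i : ℕ, σ ^ i) * σ + 1 := by
    conv_lhs => rw [tsum_eq_zero_add' ENNReal.summable]
    simp only [pow_succ, pow_zero, ENNReal.tsum_mul_right]
    exact add_comm _ _
  induction J with
  | zero =>
    rw [Finset.sum_range_one, hsum]
    exact le_mul_of_one_le_left' le_add_self
  | succ J ih =>
    rw [Finset.sum_range_succ]
    refine (add_le_add_left ih _).trans_eq ?_
    rw [hstep J]
    conv_rhs => rw [hsum]
    ring

/-- Only levels below `y` count, and their geometric sum is dominated by the largest of them. -/
theorem sum_levels_le {p : ℝ} (hp0 : 0 < p) (t y : ℝ≥0∞) (J : ℕ) :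
    ∑ j ∈ Finset.range J, {z : ℝ≥0∞ | 2 ^ j * t < z}.indicator (fun _ => (2 ^ j * t) ^ p) y
      ≤ (∑' i : ℕ, ((2 : ℝ≥0∞) ^ (-p)) ^ i) * y ^ p := by
  induction J with
  | zero => simp
  | succ J ih =>
    by_cases hy : 2 ^ J * t < y
    · calc _ ≤ ∑ j ∈ Finset.range (J + 1), (2 ^ j * t) ^ p :=
            Finset.sum_le_sum fun j _ => Set.indicator_le_self _ (fun _ => (2 ^ j * t) ^ p) y
        _ ≤ _ := sum_two_pow_mul_rpow_le hp0 t J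
        _ ≤ _ := mul_le_mul_right (ENNReal.rpow_le_rpow hy.le hp0.le) _
    · rw [Finset.sum_range_succ, Set.indicator_of_notMem (by exact hy), add_zero]
      exact ih

theorem tsum_two_rpow_ne_top {p : ℝ} (hp0 : 0 < p) : ∑' i : ℕ, ((2 : ℝ≥0∞) ^ (-p)) ^ i ≠ ∞ := by
  rw [ENNReal.tsum_geometric]
  refine ENNReal.inv_ne_top.2 (tsub_pos_of_lt ?_).ne'
  exact ENNReal.rpow_lt_one_of_one_lt_of_neg (by norm_num) (by linarith)

theorem eLpNorm_rpow_eq_lintegral {α ε : Type*} [MeasurableSpace α] [ENorm ε] {μ : Measure α}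
    {p : ℝ} (hp0 : 0 < p) (g : α → ε) :
    eLpNorm g (ENNReal.ofReal p) μ ^ p = ∫⁻ x, ‖g x‖ₑ ^ p ∂μ := by
  rw [eLpNorm_eq_lintegral_rpow_enorm_toReal (by simpa using hp0) ENNReal.ofReal_ne_top,
    ENNReal.toReal_ofReal hp0.le, ← ENNReal.rpow_mul, one_div_mul_cancel hp0.ne', ENNReal.rpow_one]

/-- The constant of the theorem. -/
noncomputable def hardyConst (p : ℝ) (L : ℕ) : ℝ≥0∞ :=
  atomConst p L + atomConst p L * 4 ^ p * L * ∑' i : ℕ, ((2 : ℝ≥0∞) ^ (-p)) ^ i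

theorem hardyConst_ne_top {p : ℝ} (hp0 : 0 < p) (hp1 : p < 1) (L : ℕ) : hardyConst p L ≠ ∞ :=
  ENNReal.add_ne_top.2 ⟨atomConst_ne_top hp0 hp1 L, ENNReal.mul_ne_top (ENNReal.mul_ne_top
    (ENNReal.mul_ne_top (atomConst_ne_top hp0 hp1 L)
      (ENNReal.rpow_ne_top_of_nonneg hp0.le (by simp))) (ENNReal.natCast_ne_top _))
    (tsum_two_rpow_ne_top hp0)⟩

variable {m : ℕ → ℕ} [∀ k, NeZero (m k)] {f : ℕ → G m → ℂ}

/-- `f_0` is constant and bounded by `f^*`, and the measure has mass one. -/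
theorem enorm_zero_le_of_lintegral_le (hf : ∀ n, DependsOnFirst n (f n)) {p : ℝ} (hp0 : 0 < p)
    {t : ℝ≥0∞} (ht : ∫⁻ x, maximalFunction f x ^ p ∂(haar m) ≤ t ^ p) (x : G m) :
    ‖f 0 x‖ₑ ≤ t := by
  rw [← ENNReal.rpow_le_rpow_iff hp0]
  refine le_trans ?_ ht
  calc ‖f 0 x‖ₑ ^ p = ∫⁻ _, ‖f 0 x‖ₑ ^ p ∂(haar m) := by simp
    _ ≤ _ := by
      refine lintegral_mono fun y => ENNReal.rpow_le_rpow ?_ hp0.le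
      rw [hf 0 (mem_interval_zero y x)]
      exact le_iSup (fun n => ‖f n y‖ₑ) 0

theorem exists_forall_below (hf : ∀ n, DependsOnFirst n (f n)) (K : ℕ) :
    ∃ B : ℝ, ∀ b ≥ B, ∀ x, ∀ n < K, Below f b n x := by
  choose B hB0 hB using fun n => (hf n).exists_norm_le
  have hle : ∀ n ≤ K, ∀ x, ‖f n x‖ ≤ ∑ l ∈ Finset.range (K + 1), B l := fun n hn x =>
    (hB n x).trans (Finset.single_le_sum (fun l _ => hB0 l) (Finset.mem_range.2 (by omega)))
  exact ⟨_, fun b hb x n hn i hi =>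
    ⟨(hle i (by omega) x).trans hb, fun y _ => (hle (i + 1) (by omega) y).trans hb⟩⟩

theorem weightedSum_le (hm : ∀ k, 2 ≤ m k) {L : ℕ} (hL : ∀ k, m k ≤ L) {p : ℝ}
    (hp0 : 0 < p) (hp1 : p < 1) (hf : Martingale f (filtration m) (haar m)) {t : ℝ} (ht0 : 0 < t)
    (ht : ∫⁻ x, maximalFunction f x ^ p ∂(haar m) ≤ ENNReal.ofReal t ^ p) (K : ℕ) :
    weightedSum p K (f K) ≤ hardyConst p L * ENNReal.ofReal t ^ p := by
  have hdep := dependsOnFirst_of_martingale hf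
  have h0 : ∀ x, ‖f 0 x‖ ≤ t := fun x => by
    have h := enorm_zero_le_of_lintegral_le hdep hp0 ht x
    rwa [← ofReal_norm, ENNReal.ofReal_le_ofReal_iff ht0.le] at h
  -- Up to time `K` the martingale is bounded, so stopping at a high enough level `2 ^ J * t` leaves
  -- `f K` unchanged and finitely many layers suffice.
  obtain ⟨B, hB⟩ := exists_forall_below hdep K
  obtain ⟨J, hJ⟩ : ∃ J : ℕ, B ≤ 2 ^ J * t := by
    obtain ⟨J, hJ⟩ := pow_unbounded_of_one_lt (B / t) (one_lt_two : (1 : ℝ) < 2)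
    exact ⟨J, ((div_lt_iff₀ ht0).1 hJ).le⟩
  set lev : ℕ → ℝ := fun j => 2 ^ j * t with hlev
  have hlev0 : ∀ j, t ≤ lev j := fun j => le_mul_of_one_le_left ht0.le (one_le_pow₀ one_le_two)
  have hlevs : ∀ j, lev j ≤ lev (j + 1) := fun j => by
    simp only [hlev, pow_succ']
    nlinarith [pow_pos (two_pos : (0 : ℝ) < 2) j, mul_pos (pow_pos (two_pos : (0 : ℝ) < 2) j) ht0]
  have hofReal : ∀ j, ENNReal.ofReal (lev j) = 2 ^ j * ENNReal.ofReal t := fun j => by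
    rw [hlev, ENNReal.ofReal_mul (by positivity), ENNReal.ofReal_pow (by norm_num)]
    simp
  -- The indices `j < J` carry the layers; the spare index `J` holds the part below level `t`.
  set g : ℕ → G m → ℂ := fun j =>
    if j = J then stopped f (Below f t) K else layer f (lev j) (lev (j + 1)) K with hg
  have hgJ : g J = stopped f (Below f t) K := by simp [hg]
  have hgj : ∀ j ∈ Finset.range J, g j = layer f (lev j) (lev (j + 1)) K := fun j hj => by
    simp [hg, (Finset.mem_range.1 hj).ne]
  have hdecomp : f K = fun x => ∑ j ∈ Finset.range (J + 1), g j x := by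
    funext x
    rw [Finset.sum_range_succ, hgJ, Finset.sum_congr rfl fun j hj => by rw [hgj j hj]]
    simp only [layer]
    rw [Finset.sum_range_sub (fun j => stopped f (Below f (lev j)) K x),
      stopped_eq (hB (lev J) hJ x)]
    simp [hlev]
  have hgdep : ∀ j ∈ Finset.range (J + 1), DependsOnFirst K (g j) := fun j _ => by
    by_cases hj : j = J
    · rw [hj, hgJ]; exact dependsOnFirst_stopped hdep t K
    · simp only [hg, if_neg hj]
      exact fun x y hy => by
        rw [layer, layer, dependsOnFirst_stopped hdep _ K hy, dependsOnFirst_stopped hdep _ K hy]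
  have hbot : weightedSum p K (stopped f (Below f t) K)
      ≤ atomConst p L * ENNReal.ofReal t ^ p := by
    have h := weightedSum_atom_le (N := 0) (c := (0 : G m)) (A := ENNReal.ofReal t) hm hL hp0 hp1
      (dependsOnFirst_stopped hdep t K) (fun x => by
        rw [Set.indicator_of_mem (mem_interval_zero _ _), ← ofReal_norm]
        exact ENNReal.ofReal_le_ofReal (norm_stopped_le (h0 x) K)) (fun h => absurd rfl h) K
    simpa [M] using h
  have hlay : ∀ j, weightedSum p K (layer f (lev j) (lev (j + 1)) K)
      ≤ atomConst p L * 4 ^ p * L * ((2 ^ j * ENNReal.ofReal t) ^ p *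
        haar m {x | 2 ^ j * ENNReal.ofReal t < maximalFunction f x}) := fun j => by
    have h := weightedSum_layer_le hm hL hp0 hp1 hf (ht0.le.trans (hlev0 j)) (hlevs j)
      (fun x => (h0 x).trans (hlev0 j)) K
    -- One factor 2 comes from subtracting two stopped martingales, the other from the upper level
    -- being twice the lower.
    have h4 : ENNReal.ofReal (2 * lev (j + 1)) = 4 * (2 ^ j * ENNReal.ofReal t) := by
      rw [ENNReal.ofReal_mul (by norm_num), hofReal, pow_succ, ENNReal.ofReal_ofNat]
      ring
    rw [hofReal, h4, ENNReal.mul_rpow_of_nonneg _ _ hp0.le] at h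
    exact h.trans_eq (by ring)
  have hlevels : ∑ j ∈ Finset.range J, (2 ^ j * ENNReal.ofReal t) ^ p *
      haar m {x | 2 ^ j * ENNReal.ofReal t < maximalFunction f x}
      ≤ (∑' i : ℕ, ((2 : ℝ≥0∞) ^ (-p)) ^ i) * ENNReal.ofReal t ^ p := by
    have hmeas : ∀ j : ℕ, MeasurableSet {x | 2 ^ j * ENNReal.ofReal t < maximalFunction f x} :=
      fun j => measurableSet_lt measurable_const (measurable_maximalFunction hdep)
    simp only [← lintegral_indicator_const (hmeas _)]
    rw [← lintegral_finsetSum _ fun j _ => measurable_const.indicator (hmeas j)]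
    refine le_trans ?_ (mul_le_mul_right ht _)
    rw [← lintegral_const_mul _ ((measurable_maximalFunction hdep).pow_const p)]
    exact lintegral_mono fun x => sum_levels_le hp0 _ (maximalFunction f x) J
  rw [hdecomp]
  refine (weightedSum_sum_le hm hp0 hp1 _ g hgdep K).trans ?_
  rw [Finset.sum_range_succ, hgJ, hardyConst, add_mul, add_comm]
  refine add_le_add hbot ?_
  calc _ ≤ ∑ j ∈ Finset.range J, atomConst p L * 4 ^ p * L * ((2 ^ j * ENNReal.ofReal t) ^ p *
        haar m {x | 2 ^ j * ENNReal.ofReal t < maximalFunction f x}) :=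
        Finset.sum_le_sum fun j hj => by rw [hgj j hj]; exact hlay j
    _ ≤ _ := by
        rw [← Finset.mul_sum, mul_assoc _ _ (ENNReal.ofReal t ^ p)]
        exact mul_le_mul_right hlevels _

theorem tsum_partialSum_le (hm : ∀ k, 2 ≤ m k) {p : ℝ} (hp0 : 0 < p)
    (hf : Martingale f (filtration m) (haar m)) {B : ℝ≥0∞}
    (hB : ∀ K, weightedSum p K (f K) ≤ B) :
    ∑' k : ℕ, eLpNorm (partialSum f (k + 1)) (ENNReal.ofReal p) (haar m) ^ p
      / ((k + 1 : ℕ) : ℝ≥0∞) ^ (2 - p) ≤ B := by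
  rw [ENNReal.tsum_eq_iSup_nat]
  refine iSup_le fun R => le_trans ?_ (hB (R + 1))
  -- Time `K = R + 1` already determines the first `R` partial sums, and the range `1 ≤ k < M_K`
  -- contains their indices.
  have hR : R + 1 ≤ M m (R + 1) := (lt_M hm _).le
  calc _ = ∑ k ∈ Finset.Ico 1 (R + 1),
        (∫⁻ x, ‖fourierSum (f (R + 1)) k x‖ₑ ^ p ∂(haar m)) / (k : ℝ≥0∞) ^ (2 - p) := by
        rw [Finset.sum_Ico_eq_sum_range]
        refine Finset.sum_congr rfl fun k hk => ?_
        have hk' := Finset.mem_range.1 hk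
        rw [eLpNorm_rpow_eq_lintegral hp0,
          partialSum_eq_fourierSum hm hf (K := R + 1) (by omega), add_comm k 1]
    _ ≤ _ := Finset.sum_le_sum_of_subset (Finset.Ico_subset_Ico_right hR)

end Assembly

end Vilenkin

theorem corollary1 (p : ℝ) (hp0 : 0 < p) (hp1 : p < 1) (L : ℕ) :
    ∃ c : ℝ≥0, ∀ m : ℕ → ℕ, (∀ k, 2 ≤ m k) → (∀ k, m k ≤ L) →
      ∀ f : ℕ → Vilenkin.G m → ℂ, Vilenkin.MemHardy p f →
        ∑' k : ℕ, eLpNorm (Vilenkin.partialSum f (k + 1)) (ENNReal.ofReal p) (Vilenkin.haar m) ^ p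
            / ((k + 1 : ℕ) : ℝ≥0∞) ^ (2 - p)
          ≤ (c : ℝ≥0∞) * Vilenkin.hardyNorm p f ^ p := by
  have hC := Vilenkin.hardyConst_ne_top hp0 hp1 L
  refine ⟨(Vilenkin.hardyConst p L).toNNReal, fun m hm hL f ⟨hf, hfin⟩ => ?_⟩
  have : ∀ k, NeZero (m k) := fun k => ⟨by have := hm k; omega⟩
  rw [ENNReal.coe_toNNReal hC]
  set h : ℝ := (Vilenkin.hardyNorm p f).toReal with hh
  -- The levels `2 ^ j * t` require `t > 0`, while `h` may be zero; hence the bound for every `t >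
  -- h`, followed by a limit.
  have hle : ∀ t : ℝ, h < t → ∑' k : ℕ,
      eLpNorm (Vilenkin.partialSum f (k + 1)) (ENNReal.ofReal p) (Vilenkin.haar m) ^ p
        / ((k + 1 : ℕ) : ℝ≥0∞) ^ (2 - p) ≤ Vilenkin.hardyConst p L * ENNReal.ofReal t ^ p := by
    intro t ht
    refine Vilenkin.tsum_partialSum_le hm hp0 hf fun K =>
      Vilenkin.weightedSum_le hm hL hp0 hp1 hf (ENNReal.toReal_nonneg.trans_lt ht) ?_ K
    have h1 : Vilenkin.hardyNorm p f ≤ ENNReal.ofReal t :=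
      (ENNReal.le_ofReal_iff_toReal_le hfin.ne (ENNReal.toReal_nonneg.trans ht.le)).2 ht.le
    have h2 := ENNReal.rpow_le_rpow h1 hp0.le
    rw [Vilenkin.hardyNorm, Vilenkin.eLpNorm_rpow_eq_lintegral hp0] at h2
    simpa using h2
  have hlim : Tendsto (fun t : ℝ => Vilenkin.hardyConst p L * ENNReal.ofReal t ^ p) (𝓝[>] h)
      (𝓝 (Vilenkin.hardyConst p L * ENNReal.ofReal h ^ p)) := by
    have hcont : Continuous fun t : ℝ => Vilenkin.hardyConst p L * ENNReal.ofReal t ^ p :=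
      (ENNReal.continuous_const_mul hC).comp
        ((ENNReal.continuous_rpow_const).comp ENNReal.continuous_ofReal)
    exact (hcont.tendsto h).mono_left nhdsWithin_le_nhds
  rw [← ENNReal.ofReal_toReal hfin.ne]
  exact ge_of_tendsto hlim (eventually_nhdsWithin_of_forall hle)
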